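/- **Setting.** Let $V\subset\mathbb P^n(\mathbb C)$ be an (irreducible) projective subvariety of dimension $k\ge 1$ with homogeneous ideal $I(V)\subset\mathbb C[x_0,\dots,x_n]$. For $d\ge 1$ let $H_d$ be the space of homogeneous polynomials of degree $d$, let $I_d(V)=H_d/(I(V)\cap H_d)$ and $M=\dim I_d(V)-1$, and fix $v_0,\dots,v_M\in H_d$ whose classes form a basis of $I_d(V)$. Let $Q_1,\dots,Q_q\in H_d\setminus I(V)$, write $[Q_j]=\sum_{i=0}^M a_{ji}[v_i]$, let $D_j=\{Q_j=0\}$, and let $$\Delta=\max_{\varnothing\ne\Gamma\subset\{1,\dots,q\}}\frac{\#\Gamma}{k-\dim\big(V\cap\bigcap_{j\in\Gamma}D_j\big)}\qquad(\dim\varnothing=-\infty)$$ be the distributive constant of $D_1,\dots,D_q$ with respect to $V$. Assume $q>\Delta(M+1)$. Let $f:\mathbb C\to V$ be a holomorphic curve with reduced representation $\tilde f=(f_0,\dots,f_n)$ (entire functions without common zeros). It is nondegenerate over $I_d(V)$ if no $P\in H_d\setminus I(V)$ satisfies $P(\tilde f)\equiv 0$. Put $F=(v_0(\tilde f),\dots,v_M(\tilde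 f))$ and $F_p=F\wedge F'\wedge\dots\wedge F^{(p)}\in\bigwedge^{p+1}\mathbb C^{M+1}$ for $0\le p\le M$. Let $|\cdot|$ be the norm of the canonical hermitian product $\langle\,,\rangle$, which is conjugate linear in its second argument. Let $F_p(Q_j)=F_p\vee(\overline{a_{j0}},\dots,\overline{a_{jM}})\in\bigwedge^{p}\mathbb C^{M+1}$, where the interior product $A\vee H$ is defined by $\langle A\vee H,D\rangle=\langle A,H\wedge D\rangle$ for all $D$; thus $|F_0(Q_j)|=|Q_j(\tilde f)|$. The contact functions are $$\varphi_p(Q_j)=\frac{|F_p(Q_j)|^2}{|F_p|^2}.$$ Let $dd^c u=\frac{\sqrt{-1}}{2\pi}\,\partial\bar\partial u$, so that $dd^c|z|^2=\frac{\sqrt{-1}}{2\pi}dz\wedge d\bar z$. **Theorem 3.5.** For every $\epsilon>0$ there exist $\delta>1$ and $C>0$, depending only on $\epsilon$ and on $V,d,v_0,\dots,v_M,Q_1,\dots,Q_q$ (and not on $f$), such that for every holomorphic curve $f:\mathbb C\to V$ which is nondegenerate over $I_d(V)$ and every reduced representation $\tilde f$ of $f$, the following holds at every point of $\mathbb C$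 where none of the functions $F_p$ and $\varphi_p(Q_j)$, $0\le p\le M-1$, $1\le j\le q$, vanishes: one has $\varphi_p(Q_j)<\delta$ for all $0\le p\le M-1$ and all $j$, the function whose $dd^c$ is taken on the left-hand side below is of class $C^2$ near the point, and $$dd^c\log\frac{\prod_{p=0}^{M-1}|F_p|^{2\epsilon}}{\prod_{j=1}^{q}\prod_{p=0}^{M-1}\log^{2/\Delta}\big(\delta/\varphi_p(Q_j)\big)}\ \ge\ C\left(\frac{|F_0|^{2\left(\frac q\Delta-M-1\right)}\,|F_M|^2}{\prod_{j=1}^q\Big(|F_0(Q_j)|^2\prod_{p=0}^{M-1}\log^2\big(\delta/\varphi_p(Q_j)\big)\Big)^{1/\Delta}}\right)^{\frac{2}{M(M+1)}}dd^c|z|^2 .$$ -/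

import Mathlib

open scoped LinearAlgebra.Projectivization

namespace HolCurve

/-! ### Projective varieties over the complex numbers -/

/-- Projective space `ℙⁿ(ℂ)`. -/
abbrev ProjSpace (n : ℕ) : Type := ℙ ℂ (Fin (n + 1) → ℂ)

/-- The zero set in `ℙⁿ(ℂ)` of a polynomial. It is used for homogeneous polynomials only, for which
it does not depend on the choice of the homogeneous coordinates `x.rep` of the point `x`. -/
def hypersurface {n : ℕ} (P : MvPolynomial (Fin (n + 1)) ℂ) : Set (ProjSpace n) :=
  {x | MvPolynomial.eval x.rep P = 0}

/-- The set of all homogeneous coordinate vectors of the points of `W`. -/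
def puncturedCone {n : ℕ} (W : Set (ProjSpace n)) : Set (Fin (n + 1) → ℂ) :=
  {x | ∃ hx : x ≠ 0, Projectivization.mk ℂ x hx ∈ W}

/-- The homogeneous ideal `I(W)` of `W ⊆ ℙⁿ(ℂ)`: the polynomials vanishing at all homogeneous
coordinate vectors of all points of `W`. (It is the unit ideal if `W` is empty.) -/
noncomputable def homIdeal {n : ℕ} (W : Set (ProjSpace n)) : Ideal (MvPolynomial (Fin (n + 1)) ℂ) :=
  MvPolynomial.vanishingIdeal ℂ (puncturedCone W)

/-- `W` is a projective subvariety of `ℙⁿ(ℂ)`: the common zero set of a set of homogeneous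
polynomials, irreducible (and non-empty), i.e. with prime homogeneous ideal. -/
structure IsProjectiveVariety {n : ℕ} (W : Set (ProjSpace n)) : Prop where
  closed : ∃ S : Set (MvPolynomial (Fin (n + 1)) ℂ),
    (∀ P ∈ S, ∃ e : ℕ, P.IsHomogeneous e) ∧ W = ⋂ P ∈ S, hypersurface P
  irreducible : (homIdeal W).IsPrime

/-- The dimension of a non-empty projective algebraic set: the Krull dimension of its homogeneous
coordinate ring, minus one. (The empty set, of dimension `-∞`, is treated apart where it occurs.) -/
noncomputable def projDim {n : ℕ} (W : Set (ProjSpace n)) : ℕ :=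
  ((ringKrullDim (MvPolynomial (Fin (n + 1)) ℂ ⧸ homIdeal W)).unbotD 0).toNat - 1

open Classical in
/-- The distributive constant of the hypersurfaces `Q₁ = 0, …, Q_q = 0` with respect to `V`: the
maximum over the non-empty `Γ ⊆ {1, …, q}` of `#Γ / (dim V - dim (V ∩ ⋂_{j ∈ Γ} {Q_j = 0}))`, where
the quotient is `0` if the intersection is empty, since then its dimension is `-∞`. -/
noncomputable def distributiveConstant {n q : ℕ} (V : Set (ProjSpace n))
    (Q : Fin q → MvPolynomial (Fin (n + 1)) ℂ) : ℝ :=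
  ⨆ Γ : {Γ : Finset (Fin q) // Γ.Nonempty},
    if V ∩ ⋂ j ∈ Γ.1, hypersurface (Q j) = ∅ then 0
    else (Γ.1.card : ℝ) / ((projDim V : ℝ) - (projDim (V ∩ ⋂ j ∈ Γ.1, hypersurface (Q j)) : ℝ))

/-- `H_d`, the space of homogeneous polynomials of degree `d` in `x₀, …, x_n`. -/
abbrev HomPoly (n d : ℕ) : Type := MvPolynomial.homogeneousSubmodule (Fin (n + 1)) ℂ d

/-- `I(V) ∩ H_d`, as a subspace of `H_d`. -/
noncomputable def homIdealPart {n : ℕ} (V : Set (ProjSpace n)) (d : ℕ) :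
    Submodule ℂ (HomPoly n d) :=
  ((homIdeal V).restrictScalars ℂ).comap (MvPolynomial.homogeneousSubmodule (Fin (n + 1)) ℂ d).subtype

/-- `I_d(V) = H_d / (I(V) ∩ H_d)`. -/
abbrev CoordPart {n : ℕ} (V : Set (ProjSpace n)) (d : ℕ) : Type := HomPoly n d ⧸ homIdealPart V d

/-! ### Holomorphic curves -/

/-- `ft` is a reduced representation of `f : ℂ → ℙⁿ(ℂ)`: its components are entire functions without
common zero, and they are homogeneous coordinates of `f` at every point. The maps which have a
reduced representation are exactly the holomorphic maps `ℂ → ℙⁿ(ℂ)`. -/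
structure IsReducedRepresentation {n : ℕ} (f : ℂ → ProjSpace n) (ft : ℂ → Fin (n + 1) → ℂ) :
    Prop where
  holomorphic : ∀ i, Differentiable ℂ fun z => ft z i
  represents : ∀ z, ∃ h : ft z ≠ 0, Projectivization.mk ℂ (ft z) h = f z

/-- `f` is degenerate over `I_d(V)`: some `[P] ≠ 0` in `I_d(V)` satisfies `P(ft) ≡ 0` for a reduced
representation `ft` of `f`. -/
def IsDegenerateOver {n : ℕ} (V : Set (ProjSpace n)) (d : ℕ) (f : ℂ → ProjSpace n) : Prop :=
  ∃ P : HomPoly n d, (homIdealPart V d).mkQ P ≠ 0 ∧ ∃ ft : ℂ → Fin (n + 1) → ℂ,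
    IsReducedRepresentation f ft ∧ ∀ z, MvPolynomial.eval (ft z) (P : MvPolynomial _ ℂ) = 0

/-! ### Hermitian multilinear algebra on the exterior powers of `ℂᵐ` -/

/-- `⋀ʳ ℂᵐ`. -/
abbrev ExtPow (m r : ℕ) : Type := ⋀[ℂ]^r (Fin m → ℂ)

/-- The basis `e_{i₁} ∧ ⋯ ∧ e_{i_r}`, `i₁ < ⋯ < i_r`, of `⋀ʳ ℂᵐ`. -/
noncomputable def extBasis (m r : ℕ) : Module.Basis (Set.powersetCard (Fin m) r) ℂ (ExtPow m r) :=
  (Pi.basisFun ℂ (Fin m)).exteriorPower r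

/-- The canonical hermitian product on `⋀ʳ ℂᵐ` (linear in the first and conjugate linear in the
second argument), for which the basis `e_{i₁} ∧ ⋯ ∧ e_{i_r}` is orthonormal. -/
noncomputable def herm {m r : ℕ} (A B : ExtPow m r) : ℂ :=
  ∑ s, (extBasis m r).repr A s * starRingEnd ℂ ((extBasis m r).repr B s)

/-- The norm on `⋀ʳ ℂᵐ`. -/
noncomputable def extNorm {m r : ℕ} (A : ExtPow m r) : ℝ :=
  Real.sqrt (∑ s, ‖(extBasis m r).repr A s‖ ^ 2)

/-- The map `D ↦ H ∧ D` from `⋀ʳ ℂᵐ` to `⋀ʳ⁺¹ ℂᵐ`, for a vector `H`. -/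
noncomputable def wedge {m r : ℕ} (H : Fin m → ℂ) : ExtPow m r →ₗ[ℂ] ExtPow m (r + 1) :=
  (LinearMap.mulLeft ℂ (ExteriorAlgebra.ι ℂ H)).restrict fun x hx => by
    have h := Submodule.mul_mem_mul (LinearMap.mem_range_self (ExteriorAlgebra.ι ℂ) H) hx
    rw [← pow_succ'] at h
    exact h

/-- The interior product `A ∨ H` of `A ∈ ⋀ʳ⁺¹ ℂᵐ` and a vector `H`: the unique element of `⋀ʳ ℂᵐ`
with `⟨A ∨ H, D⟩ = ⟨A, H ∧ D⟩` for all `D`, see `herm_interiorProduct` and `eq_interiorProduct`. -/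
noncomputable def interiorProduct {m r : ℕ} (A : ExtPow m (r + 1)) (H : Fin m → ℂ) : ExtPow m r :=
  ∑ s, herm A (wedge H (extBasis m r s)) • extBasis m r s

theorem herm_interiorProduct {m r : ℕ} (A : ExtPow m (r + 1)) (H : Fin m → ℂ) (D : ExtPow m r) :
    herm (interiorProduct A H) D = herm A (wedge H D) := by
  classical
  have h1 : ∀ s, (extBasis m r).repr (interiorProduct A H) s = herm A (wedge H (extBasis m r s)) := by
    intro s
    simp [interiorProduct, Finsupp.single_apply]
  have h2 : wedge H D = ∑ s, (extBasis m r).repr D s • wedge H (extBasis m r s) := by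
    conv_lhs => rw [← (extBasis m r).sum_repr D]
    rw [map_sum]
    simp only [map_smul]
  rw [h2]
  unfold herm at h1 ⊢
  simp only [h1, map_sum, map_smul, Finsupp.coe_finsetSum, Finset.sum_apply, Finsupp.smul_apply,
    smul_eq_mul, map_mul, Finset.mul_sum, Finset.sum_mul]
  rw [Finset.sum_comm]
  refine Finset.sum_congr rfl fun s _ => Finset.sum_congr rfl fun t _ => ?_
  ring

theorem eq_interiorProduct {m r : ℕ} (A : ExtPow m (r + 1)) (H : Fin m → ℂ) (C : ExtPow m r)
    (hC : ∀ D, herm C D = herm A (wedge H D)) : C = interiorProduct A H := by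
  classical
  refine (extBasis m r).ext_elem fun s => ?_
  have h := (hC (extBasis m r s)).trans (herm_interiorProduct A H (extBasis m r s)).symm
  simpa [herm, Finsupp.single_apply] using h

/-! ### Derived curves and contact functions -/

section Contact

variable {n d M : ℕ}

/-- The vector `F^{(l)} = (v₀(ft)^{(l)}, …, v_M(ft)^{(l)})` of `l`-th derivatives, at `z`. -/
noncomputable def curveDeriv (v : Fin (M + 1) → HomPoly n d) (ft : ℂ → Fin (n + 1) → ℂ) (l : ℕ)
    (z : ℂ) : Fin (M + 1) → ℂ :=
  fun i => iteratedDeriv l (fun w => MvPolynomial.eval (ft w) (v i : MvPolynomial _ ℂ)) z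

/-- `F_p = F^{(0)} ∧ F^{(1)} ∧ ⋯ ∧ F^{(p)}`, at `z`. -/
noncomputable def derivedCurve (v : Fin (M + 1) → HomPoly n d) (ft : ℂ → Fin (n + 1) → ℂ) (p : ℕ)
    (z : ℂ) : ExtPow (M + 1) (p + 1) :=
  exteriorPower.ιMulti ℂ (p + 1) fun l : Fin (p + 1) => curveDeriv v ft (l : ℕ) z

/-- `F_p(Q) = F_p ∨ H`, at `z`, where `a` is the vector of coordinates of `[Q]` in the basis
`[v₀], …, [v_M]`. The vector `H` has the components `conj a_i`, because the interior product is
conjugate linear in `H`; so `F₀(Q) = a₀ v₀(ft) + ⋯ + a_M v_M(ft) = Q(ft)`. -/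
noncomputable def contactVector (v : Fin (M + 1) → HomPoly n d) (ft : ℂ → Fin (n + 1) → ℂ)
    (a : Fin (M + 1) → ℂ) (p : ℕ) (z : ℂ) : ExtPow (M + 1) p :=
  interiorProduct (derivedCurve v ft p z) fun i => starRingEnd ℂ (a i)

/-- The `p`-th contact function `φ_p(Q) = |F_p(Q)|² / |F_p|²`. -/
noncomputable def contactFunction (v : Fin (M + 1) → HomPoly n d) (ft : ℂ → Fin (n + 1) → ℂ)
    (a : Fin (M + 1) → ℂ) (p : ℕ) (z : ℂ) : ℝ :=
  extNorm (contactVector v ft a p z) ^ 2 / extNorm (derivedCurve v ft p z) ^ 2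

end Contact

/-- The density of `dd^c u = (√-1 / 2π) ∂∂̄u` with respect to `(√-1 / 2π) dz ∧ dz̄`, that is
`∂²u / ∂z∂z̄`, a quarter of the Laplacian, for a function `u` which is `C²` near `z`. -/
noncomputable def ddc (u : ℂ → ℝ) (z : ℂ) : ℝ := Laplacian.laplacian u z / 4

end HolCurve

open HolCurve

open HolCurve

namespace HolCurve

open Matrix

/-! ### The hermitian product on exterior powers -/

section Hermitian

variable {m r : ℕ}

/-! Write $\Omega_p=|F_{p-1}|^2|F_{p+1}|^2/|F_p|^4$ with $|F_{-1}|=1$. Everything is computed at one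
point, in an orthonormal frame adapted by Gram–Schmidt to $F,F',F'',\dots$. There $|F_p|^2$ is a
product of diagonal entries, and $\varphi_p(Q_j)$ is the squared length of the projection of
$\overline{a_j}$ to the span of the first $p+1$ frame vectors.

The frame gives $dd^c\log|F_p|^2=\Omega_p$ (`wirtinger_log_extNorm_wedgeSeq`) and, for
$L=\log(\delta/\varphi_p)\ge 1$, the bound $-dd^c\log
L\ge(\varphi_{p+1}/(\varphi_pL^2)-2/L)\,\Omega_p$ (`exists_wirtinger_log_log`). A large $\delta$
makes all logarithms large, so that the terms $\epsilon\,\Omega_p$ absorb the errors $2/L$. What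
remains is $\frac2\Delta\sum_p\Omega_p\sum_j\Phi_{jp}$ with
$\Phi_{jp}=\varphi_{p+1}(Q_j)/(\varphi_p(Q_j)L_{jp}^2)$ (`contDiffAt_and_le_ddc`).

The sum over $j$ is bounded below by a product. If $\varphi_p(Q_j)=0$ for all $j\in\Gamma$, then the
point lies on $V\cap\bigcap_\Gamma D_j$, and the $a_j$ span a space of dimension at most $M-p$.
Cutting $V$ by forms of rank $r$ lowers its dimension by at most $r$, so the definition of $\Delta$
gives $\#\Gamma\le\Delta(M-p)$ (`card_le_distributiveConstant_mul`). By compactness at most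
$\Delta(M-p)$ of the $\varphi_p(Q_j)$ lie below a constant that does not depend on $f$
(`exists_card_contact_small_le`). Hence $\prod_j\Phi_{jp}^{1/(\Delta(M-p))}$ is at most a constant
times $\sum_j\Phi_{jp}$ (`prod_rpow_le_mul_sum`).

Finally the weighted inequality of means with weights $2(M-p)/(M(M+1))$ cancels the $M-p$ in the
exponents. The contact functions telescope from $\varphi_0$ to the constant $\varphi_M=|a_j|^2$, and
the $\Omega_p$ combine to $|F_M|^2/|F_0|^{2(M+1)}$ (`telescoping_mean_inequality`). -/

theorem herm_add_left (A A' B : ExtPow m r) : herm (A + A') B = herm A B + herm A' B := by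
  rw [herm, herm, herm, ← Finset.sum_add_distrib]
  refine Finset.sum_congr rfl fun s _ => ?_
  rw [map_add, Finsupp.add_apply, add_mul]

theorem herm_smul_left (c : ℂ) (A B : ExtPow m r) : herm (c • A) B = c * herm A B := by
  rw [herm, herm, Finset.mul_sum]
  refine Finset.sum_congr rfl fun s _ => ?_
  rw [map_smul, Finsupp.smul_apply, smul_eq_mul, mul_assoc]

theorem herm_conj_symm (A B : ExtPow m r) : starRingEnd ℂ (herm B A) = herm A B := by
  rw [herm, herm, map_sum]
  refine Finset.sum_congr rfl fun s _ => ?_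
  rw [map_mul, Complex.conj_conj, mul_comm]

theorem herm_add_right (A B B' : ExtPow m r) : herm A (B + B') = herm A B + herm A B' := by
  rw [← herm_conj_symm, herm_add_left, map_add, herm_conj_symm, herm_conj_symm]

theorem herm_smul_right (c : ℂ) (A B : ExtPow m r) :
    herm A (c • B) = starRingEnd ℂ c * herm A B := by
  rw [← herm_conj_symm, herm_smul_left, map_mul, herm_conj_symm]

/-- The hermitian product as a linear form in its first argument. -/
noncomputable def hermLeft (B : ExtPow m r) : ExtPow m r →ₗ[ℂ] ℂ where
  toFun A := herm A B
  map_add' A A' := herm_add_left A A' B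
  map_smul' c A := herm_smul_left c A B

@[simp]
theorem hermLeft_apply (A B : ExtPow m r) : hermLeft B A = herm A B := rfl

theorem herm_sum_left {ι : Type*} (s : Finset ι) (A : ι → ExtPow m r) (B : ExtPow m r) :
    herm (∑ i ∈ s, A i) B = ∑ i ∈ s, herm (A i) B :=
  map_sum (hermLeft B) A s

theorem herm_sum_right {ι : Type*} (s : Finset ι) (A : ExtPow m r) (B : ι → ExtPow m r) :
    herm A (∑ i ∈ s, B i) = ∑ i ∈ s, herm A (B i) := by
  rw [← herm_conj_symm, herm_sum_left, map_sum]
  exact Finset.sum_congr rfl fun i _ => herm_conj_symm _ _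

theorem extNorm_nonneg (A : ExtPow m r) : 0 ≤ extNorm A := Real.sqrt_nonneg _

theorem extNorm_sq (A : ExtPow m r) : extNorm A ^ 2 = ∑ s, ‖(extBasis m r).repr A s‖ ^ 2 :=
  Real.sq_sqrt (Finset.sum_nonneg fun _ _ => sq_nonneg _)

theorem herm_self (A : ExtPow m r) : herm A A = ((extNorm A ^ 2 : ℝ) : ℂ) := by
  rw [extNorm_sq, herm]
  push_cast
  exact Finset.sum_congr rfl fun s _ => Complex.mul_conj' _

theorem extNorm_sq_eq_re (A : ExtPow m r) : extNorm A ^ 2 = (herm A A).re := by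
  rw [herm_self, Complex.ofReal_re]

theorem extNorm_smul_sq (c : ℂ) (A : ExtPow m r) :
    extNorm (c • A) ^ 2 = ‖c‖ ^ 2 * extNorm A ^ 2 := by
  simp [extNorm_sq, Finset.mul_sum, mul_pow]

theorem extNorm_eq_zero (A : ExtPow m r) : extNorm A = 0 ↔ A = 0 := by
  rw [← sq_eq_zero_iff (a := extNorm A), extNorm_sq,
    Finset.sum_eq_zero_iff_of_nonneg fun _ _ => sq_nonneg _]
  constructor
  · intro h
    refine (extBasis m r).ext_elem fun s => ?_
    simpa using h s (Finset.mem_univ s)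
  · rintro rfl
    simp

theorem extNorm_pos {A : ExtPow m r} (h : A ≠ 0) : 0 < extNorm A :=
  lt_of_le_of_ne (extNorm_nonneg A) fun h0 => h ((extNorm_eq_zero A).1 h0.symm)

theorem extBasis_repr_ιMulti (w : Fin r → Fin m → ℂ) (s : Set.powersetCard (Fin m) r) :
    (extBasis m r).repr (exteriorPower.ιMulti ℂ r w) s =
      (Matrix.of fun i j => w i (Set.powersetCard.ofFinEmbEquiv.symm s j)).det := by
  rw [extBasis, exteriorPower.basis_repr_apply, exteriorPower.ιMultiDual_apply_ιMulti]
  simp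

/-- The hermitian product of decomposable vectors is a Gram determinant. -/
theorem herm_ιMulti_ιMulti (u w : Fin r → Fin m → ℂ) :
    herm (exteriorPower.ιMulti ℂ r u) (exteriorPower.ιMulti ℂ r w) =
      (Matrix.of fun i j => u i ⬝ᵥ star (w j)).det := by
  -- Both sides are linear forms, so they need only be compared on the basis, where each is the
  -- conjugate of a minor of `w`.
  have key : hermLeft (exteriorPower.ιMulti ℂ r w) =
      exteriorPower.pairingDual ℂ (Fin m → ℂ) r
        (exteriorPower.ιMulti ℂ r fun j => dotProductBilin ℂ ℂ (star (w j))) := by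
    refine (extBasis m r).ext fun s => ?_
    have h1 : hermLeft (exteriorPower.ιMulti ℂ r w) (extBasis m r s) =
        starRingEnd ℂ ((extBasis m r).repr (exteriorPower.ιMulti ℂ r w) s) := by
      simp [herm, Finsupp.single_apply]
    rw [h1, extBasis_repr_ιMulti, extBasis, exteriorPower.basis_apply, exteriorPower.ιMulti_family,
      exteriorPower.pairingDual_ιMulti_ιMulti, RingHom.map_det, ← Matrix.det_transpose]
    congr 1
    ext i j
    simp
  have := congrArg (fun T => T (exteriorPower.ιMulti ℂ r u)) key
  simp only [hermLeft_apply, exteriorPower.pairingDual_ιMulti_ιMulti] at this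
  rw [this]
  congr 1
  ext i j
  simp [dotProduct_comm]

theorem wedge_ιMulti (H : Fin m → ℂ) (w : Fin r → Fin m → ℂ) :
    wedge H (exteriorPower.ιMulti ℂ r w) = exteriorPower.ιMulti ℂ (r + 1) (Fin.cons H w) := by
  apply Subtype.ext
  simp [wedge, ExteriorAlgebra.ιMulti_succ_apply]
  rfl

/-- A family of vectors of `ℂᵐ` which is orthonormal for the canonical hermitian product. -/
def IsOrthonormal {ι : Type*} [DecidableEq ι] (e : ι → Fin m → ℂ) : Prop :=
  ∀ i j, e i ⬝ᵥ star (e j) = if i = j then 1 else 0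

theorem IsOrthonormal.comp {ι κ : Type*} [DecidableEq ι] [DecidableEq κ] {e : ι → Fin m → ℂ}
    (he : IsOrthonormal e) {g : κ → ι} (hg : Function.Injective g) :
    IsOrthonormal fun k => e (g k) := by
  intro i j
  rw [he]
  simp [hg.eq_iff]

theorem IsOrthonormal.extNorm_ιMulti {e : Fin r → Fin m → ℂ} (he : IsOrthonormal e) :
    extNorm (exteriorPower.ιMulti ℂ r e) = 1 := by
  have h : extNorm (exteriorPower.ιMulti ℂ r e) ^ 2 = 1 := by
    rw [extNorm_sq_eq_re, herm_ιMulti_ιMulti]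
    have : (Matrix.of fun i j => e i ⬝ᵥ star (e j)) = 1 := by
      ext i j
      simp [he i j, Matrix.one_apply]
    simp [this]
  exact (pow_eq_one_iff_of_nonneg (extNorm_nonneg _) two_ne_zero).1 h

/-- Laplace expansion, along the column of `H`, of the Gram determinant of `e` against `H ∧ D`. -/
theorem interiorProduct_ιMulti (e : Fin (r + 1) → Fin m → ℂ) (H : Fin m → ℂ) :
    interiorProduct (exteriorPower.ιMulti ℂ (r + 1) e) H =
      ∑ i : Fin (r + 1), ((-1) ^ (i : ℕ) * (e i ⬝ᵥ star H)) •
        exteriorPower.ιMulti ℂ r fun k => e (i.succAbove k) := by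
  symm
  refine eq_interiorProduct _ _ _ fun D => ?_
  rw [← (extBasis m r).sum_repr D]
  simp only [map_sum, map_smul, herm_sum_right, herm_smul_right]
  refine Finset.sum_congr rfl fun s _ => ?_
  congr 1
  rw [extBasis, exteriorPower.basis_apply, exteriorPower.ιMulti_family, wedge_ιMulti,
    herm_ιMulti_ιMulti, Matrix.det_succ_column_zero, herm_sum_left]
  refine Finset.sum_congr rfl fun i _ => ?_
  rw [herm_smul_left, herm_ιMulti_ιMulti]
  congr 1

theorem IsOrthonormal.herm_ιMulti_succAbove {e : Fin (r + 1) → Fin m → ℂ} (he : IsOrthonormal e)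
    {i j : Fin (r + 1)} (hij : i ≠ j) :
    herm (exteriorPower.ιMulti ℂ r fun k => e (i.succAbove k))
      (exteriorPower.ιMulti ℂ r fun k => e (j.succAbove k)) = 0 := by
  rw [herm_ιMulti_ιMulti]
  obtain ⟨k, hk⟩ := Fin.exists_succAbove_eq hij.symm
  refine Matrix.det_eq_zero_of_row_eq_zero k fun l => ?_
  rw [Matrix.of_apply, he, hk, if_neg (Fin.succAbove_ne j l).symm]

/-- The interior product with `H` contracts a unit decomposable vector by the norm of the
orthogonal projection of `H` to its subspace. -/
theorem IsOrthonormal.extNorm_interiorProduct_sq {e : Fin (r + 1) → Fin m → ℂ}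
    (he : IsOrthonormal e) (H : Fin m → ℂ) :
    extNorm (interiorProduct (exteriorPower.ιMulti ℂ (r + 1) e) H) ^ 2 =
      ∑ i, ‖e i ⬝ᵥ star H‖ ^ 2 := by
  rw [extNorm_sq_eq_re, interiorProduct_ιMulti, herm_sum_left, Complex.re_sum]
  refine Finset.sum_congr rfl fun i _ => ?_
  rw [herm_sum_right, Finset.sum_eq_single i]
  · rw [herm_smul_left, herm_smul_right, herm_self,
      (he.comp Fin.succAbove_right_injective).extNorm_ιMulti, ← mul_assoc, Complex.mul_conj']
    norm_cast
    simp
  · intro j _ hj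
    rw [herm_smul_left, herm_smul_right, he.herm_ιMulti_succAbove hj.symm]
    simp
  · simp

theorem interiorProduct_add (A B : ExtPow m (r + 1)) (H : Fin m → ℂ) :
    interiorProduct (A + B) H = interiorProduct A H + interiorProduct B H := by
  simp [interiorProduct, herm_add_left, add_smul, Finset.sum_add_distrib]

theorem interiorProduct_smul (c : ℂ) (A : ExtPow m (r + 1)) (H : Fin m → ℂ) :
    interiorProduct (c • A) H = c • interiorProduct A H := by
  simp [interiorProduct, herm_smul_left, Finset.smul_sum, mul_smul]

end Hermitian

end HolCurve

namespace HolCurve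

open Matrix

/-! ### Adapted orthonormal frames and the derived curves in them. -/

section Frames

variable {m r : ℕ}

/-- Every finite sequence of `m` vectors of `ℂᵐ` is triangular with respect to some orthonormal
basis. -/
theorem exists_triangular_frame (u : Fin m → Fin m → ℂ) :
    ∃ e : Fin m → Fin m → ℂ, IsOrthonormal e ∧
      (∀ x : Fin m → ℂ, x = ∑ j, (x ⬝ᵥ star (e j)) • e j) ∧
      ∀ i j, i < j → u i ⬝ᵥ star (e j) = 0 := by
  have hf : Module.finrank ℂ (EuclideanSpace ℂ (Fin m)) = Fintype.card (Fin m) := by simp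
  let E := InnerProductSpace.gramSchmidtOrthonormalBasis hf
    (fun i => (WithLp.toLp 2 (u i) : EuclideanSpace ℂ (Fin m)))
  refine ⟨fun i => (E i).ofLp, fun i j => ?_, fun x => ?_, fun i j hij => ?_⟩
  · have := orthonormal_iff_ite.1 E.orthonormal j i
    rw [EuclideanSpace.inner_eq_star_dotProduct] at this
    rw [this]
    simp [eq_comm]
  · have := congrArg WithLp.ofLp (E.sum_repr' (WithLp.toLp 2 x)).symm
    simpa [EuclideanSpace.inner_eq_star_dotProduct] using this
  · have := InnerProductSpace.gramSchmidtOrthonormalBasis_inv_triangular hf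
      (fun i => (WithLp.toLp 2 (u i) : EuclideanSpace ℂ (Fin m))) hij
    rwa [EuclideanSpace.inner_eq_star_dotProduct] at this

theorem ιMulti_matrix (T : Matrix (Fin r) (Fin r) ℂ) (e : Fin r → Fin m → ℂ) :
    exteriorPower.ιMulti ℂ r (fun i => ∑ j, T i j • e j) =
      T.det • exteriorPower.ιMulti ℂ r e := by
  refine (extBasis m r).ext_elem fun s => ?_
  rw [map_smul, Finsupp.smul_apply, extBasis_repr_ιMulti, extBasis_repr_ιMulti, smul_eq_mul,
    ← Matrix.det_mul]
  congr 1
  ext i j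
  simp [Matrix.mul_apply]

/-- In the vectors `e (σ k)` the family `w` has a lower triangular matrix, whose determinant is the
product of its diagonal. The injection `σ` is free because the residue below skips one frame vector.
-/
theorem ιMulti_triangular {e : Fin m → Fin m → ℂ}
    (hsum : ∀ x : Fin m → ℂ, x = ∑ j, (x ⬝ᵥ star (e j)) • e j)
    (σ : Fin r → Fin m) (hσ : Function.Injective σ) (w : Fin r → Fin m → ℂ)
    (hw : ∀ i j, (∀ k ≤ i, j ≠ σ k) → w i ⬝ᵥ star (e j) = 0) :
    exteriorPower.ιMulti ℂ r w =
      (∏ i, w i ⬝ᵥ star (e (σ i))) • exteriorPower.ιMulti ℂ r fun i => e (σ i) := by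
  have h1 : w = fun i => ∑ k, (Matrix.of fun i k => w i ⬝ᵥ star (e (σ k))) i k • e (σ k) := by
    funext i
    conv_lhs => rw [hsum (w i)]
    simp only [Matrix.of_apply]
    rw [← Finset.sum_subset (Finset.subset_univ (Finset.univ.image σ)),
      Finset.sum_image fun a _ b _ h => hσ h]
    intro j _ hj
    rw [hw i j fun k _ h => hj (by rw [h]; exact Finset.mem_image_of_mem _ (Finset.mem_univ _)),
      zero_smul]
  conv_lhs => rw [h1]
  rw [ιMulti_matrix, Matrix.det_of_isLowerTriangular]
  · rfl
  · intro i k hik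
    exact hw i (σ k) fun l hl h => absurd (hσ h) (by
      rintro rfl
      exact absurd hl (not_le.2 hik))

/-- `u₀ ∧ ⋯ ∧ u_{r-1}`. -/
noncomputable def wedgeSeq (u : ℕ → Fin m → ℂ) (r : ℕ) : ExtPow m r :=
  exteriorPower.ιMulti ℂ r fun l : Fin r => u l

/-- `u₀ ∧ ⋯ ∧ u_{r-1} ∧ u_{r+1}`. -/
noncomputable def wedgeSkip (u : ℕ → Fin m → ℂ) (r : ℕ) : ExtPow m (r + 1) :=
  exteriorPower.ιMulti ℂ (r + 1) (Function.update (fun l : Fin (r + 1) => u l) (Fin.last r)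
    (u (r + 1)))

/-- A frame adapted to a sequence of vectors `u₀, u₁, …` of `ℂᵐ`: an orthonormal basis
`e₀, …, e_{m-1}` with `u_i ∈ span(e₀, …, e_i)`. -/
structure IsAdaptedFrame (u : ℕ → Fin m → ℂ) (e : Fin m → Fin m → ℂ) : Prop where
  orthonormal : IsOrthonormal e
  sum_eq : ∀ x : Fin m → ℂ, x = ∑ j, (x ⬝ᵥ star (e j)) • e j
  triangular : ∀ i j : Fin m, i < j → u i ⬝ᵥ star (e j) = 0

theorem exists_isAdaptedFrame (u : ℕ → Fin m → ℂ) : ∃ e, IsAdaptedFrame u e := by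
  obtain ⟨e, h1, h2, h3⟩ := exists_triangular_frame fun i : Fin m => u i
  exact ⟨e, h1, h2, h3⟩

namespace IsAdaptedFrame

variable {u : ℕ → Fin m → ℂ} {e : Fin m → Fin m → ℂ}

theorem wedgeSeq_eq (h : IsAdaptedFrame u e) (hr : r ≤ m) :
    wedgeSeq u r = (∏ i : Fin r, u i ⬝ᵥ star (e (Fin.castLE hr i))) •
      exteriorPower.ιMulti ℂ r fun i => e (Fin.castLE hr i) := by
  refine ιMulti_triangular h.sum_eq (Fin.castLE hr) (Fin.castLE_injective hr) _ fun i j hj => ?_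
  refine h.triangular (Fin.castLE hr i) j ?_
  by_contra! hji
  exact hj ⟨j, lt_of_le_of_lt (Fin.le_def.1 hji) i.2⟩ (Fin.le_def.2 (Fin.le_def.1 hji)) rfl

theorem extNorm_wedgeSeq_sq (h : IsAdaptedFrame u e) (hr : r ≤ m) :
    extNorm (wedgeSeq u r) ^ 2 = ∏ i : Fin r, ‖u i ⬝ᵥ star (e (Fin.castLE hr i))‖ ^ 2 := by
  rw [h.wedgeSeq_eq hr, extNorm_smul_sq,
    (h.orthonormal.comp (Fin.castLE_injective hr)).extNorm_ιMulti, norm_prod, Finset.prod_pow]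
  ring

theorem extNorm_interiorProduct_wedgeSeq_sq (h : IsAdaptedFrame u e) (hr : r + 1 ≤ m)
    (H : Fin m → ℂ) :
    extNorm (interiorProduct (wedgeSeq u (r + 1)) H) ^ 2 =
      extNorm (wedgeSeq u (r + 1)) ^ 2 *
        ∑ i : Fin (r + 1), ‖e (Fin.castLE hr i) ⬝ᵥ star H‖ ^ 2 := by
  rw [h.extNorm_wedgeSeq_sq hr, h.wedgeSeq_eq hr, interiorProduct_smul, extNorm_smul_sq,
    (h.orthonormal.comp (Fin.castLE_injective hr)).extNorm_interiorProduct_sq, norm_prod,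
    Finset.prod_pow]

theorem sum_norm_sq (h : IsAdaptedFrame u e) (H : Fin m → ℂ) :
    ∑ i, ‖e i ⬝ᵥ star H‖ ^ 2 = ∑ i, ‖H i‖ ^ 2 := by
  have h1 : star H ⬝ᵥ H = ∑ i, (‖H i‖ ^ 2 : ℂ) := by
    simp [dotProduct, Complex.conj_mul']
  have h2 : star H ⬝ᵥ H = ∑ j, (‖e j ⬝ᵥ star H‖ ^ 2 : ℂ) := by
    conv_lhs => rhs; rw [h.sum_eq H]
    rw [dotProduct_sum]
    refine Finset.sum_congr rfl fun j _ => ?_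
    rw [dotProduct_smul, smul_eq_mul, ← Complex.conj_mul', dotProduct_comm (star H)]
    congr 1
    simp [dotProduct, mul_comm]
  exact_mod_cast h2.symm.trans h1

end IsAdaptedFrame

/-- The pointwise identity and inequality behind the formulas for `dd^c log |F_p|²` and for the
contact functions. -/
theorem exists_orthogonal_residue (u : ℕ → Fin m → ℂ) {p : ℕ} (hp : p + 2 ≤ m)
    (hX : wedgeSeq u (p + 1) ≠ 0) (H : Fin m → ℂ) :
    ∃ α : ℂ, herm (wedgeSkip u p - α • wedgeSeq u (p + 1)) (wedgeSeq u (p + 1)) = 0 ∧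
      extNorm (wedgeSkip u p - α • wedgeSeq u (p + 1)) ^ 2 * extNorm (wedgeSeq u (p + 1)) ^ 2 =
        extNorm (wedgeSeq u p) ^ 2 * extNorm (wedgeSeq u (p + 2)) ^ 2 ∧
      extNorm (wedgeSeq u p) ^ 2 * extNorm (interiorProduct (wedgeSeq u (p + 2)) H) ^ 2 ≤
        extNorm (interiorProduct (wedgeSkip u p - α • wedgeSeq u (p + 1)) H) ^ 2 *
          extNorm (wedgeSeq u (p + 1)) ^ 2 +
        extNorm (wedgeSkip u p - α • wedgeSeq u (p + 1)) ^ 2 *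
          extNorm (interiorProduct (wedgeSeq u (p + 1)) H) ^ 2 := by
  obtain ⟨e, he⟩ := exists_isAdaptedFrame u
  let ip : Fin m := ⟨p, by omega⟩
  let iq : Fin m := ⟨p + 1, by omega⟩
  have hT : u p ⬝ᵥ star (e ip) ≠ 0 := by
    intro h0
    refine hX ((extNorm_eq_zero _).1 ?_)
    rw [← sq_eq_zero_iff, he.extNorm_wedgeSeq_sq (by omega : p + 1 ≤ m), Fin.prod_univ_castSucc]
    have : ‖u p ⬝ᵥ star (e ip)‖ ^ 2 = 0 := by simp [h0]
    exact mul_eq_zero_of_right _ this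
  -- This `α` removes the `e_p`-component of `u_{p+1}`; subtracting `α • u_p` in the last slot then
  -- leaves a multiple of `e₀ ∧ ⋯ ∧ e_{p-1} ∧ e_{p+1}`, which is orthogonal to `e₀ ∧ ⋯ ∧ e_p`.
  set α : ℂ := (u (p + 1) ⬝ᵥ star (e ip)) / (u p ⬝ᵥ star (e ip)) with hα
  let σ : Fin (p + 1) → Fin m := Fin.snoc (fun i : Fin p => Fin.castLE (by omega) i) iq
  have hσc : ∀ k : Fin p, σ (Fin.castSucc k) = Fin.castLE (by omega) k := fun k => by simp [σ]
  have hσ : Function.Injective σ := by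
    intro i j hij
    induction i using Fin.lastCases with
    | last =>
      induction j using Fin.lastCases with
      | last => rfl
      | cast j =>
        simp only [σ, Fin.snoc_last, Fin.snoc_castSucc, iq, Fin.ext_iff, Fin.val_castLE] at hij
        omega
    | cast i =>
      induction j using Fin.lastCases with
      | last =>
        simp only [σ, Fin.snoc_last, Fin.snoc_castSucc, iq, Fin.ext_iff, Fin.val_castLE] at hij
        omega
      | cast j =>
        simp only [σ, Fin.snoc_castSucc, Fin.ext_iff, Fin.val_castLE] at hij
        exact Fin.ext hij
  have hR : wedgeSkip u p - α • wedgeSeq u (p + 1) =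
      ((∏ i : Fin p, u i ⬝ᵥ star (e (Fin.castLE (by omega) i))) *
        (u (p + 1) ⬝ᵥ star (e iq))) • exteriorPower.ιMulti ℂ (p + 1) fun i => e (σ i) := by
    have h1 : wedgeSkip u p - α • wedgeSeq u (p + 1) = exteriorPower.ιMulti ℂ (p + 1)
        (Function.update (fun l : Fin (p + 1) => u l) (Fin.last p) (u (p + 1) - α • u p)) := by
      rw [AlternatingMap.map_update_sub, AlternatingMap.map_update_smul]
      congr 2
      have : u p = (fun l : Fin (p + 1) => u l) (Fin.last p) := rfl
      rw [this, Function.update_eq_self]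
      rfl
    rw [h1, ιMulti_triangular he.sum_eq σ hσ, Fin.prod_univ_castSucc]
    · congr 2
      · refine Finset.prod_congr rfl fun i _ => ?_
        rw [Function.update_of_ne (Fin.castSucc_lt_last i).ne]
        simp [σ]
      · have : u p ⬝ᵥ star (e iq) = 0 := he.triangular ip iq (by simp [ip, iq, Fin.lt_def])
        simp [σ, sub_dotProduct, this]
    · intro i j hj
      induction i using Fin.lastCases with
      | last =>
        rw [Function.update_self]
        rcases lt_trichotomy (j : ℕ) p with h | h | h
        · exact absurd (hσc ⟨j, h⟩).symm (hj (Fin.castSucc ⟨j, h⟩) (Fin.le_last _))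
        · have : j = ip := Fin.ext h
          rw [this, sub_dotProduct, smul_dotProduct, hα, smul_eq_mul, div_mul_cancel₀ _ hT, sub_self]
        · have hjq : p + 1 < (j : ℕ) := by
            refine lt_of_le_of_ne h fun h' => ?_
            refine absurd ?_ (hj (Fin.last p) le_rfl)
            simp [σ, iq, h']
          rw [sub_dotProduct, smul_dotProduct, he.triangular iq j (Fin.lt_def.2 hjq),
            he.triangular ip j (Fin.lt_def.2 h)]
          simp
      | cast i =>
        rw [Function.update_of_ne (Fin.castSucc_lt_last i).ne]
        refine he.triangular (Fin.castLE (by omega) i) j ?_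
        by_contra! hji
        have hji' : (j : ℕ) ≤ i := Fin.le_def.1 hji
        refine hj (Fin.castSucc ⟨j, lt_of_le_of_lt hji' i.2⟩) ?_ (hσc ⟨j, _⟩).symm
        simpa [Fin.le_def] using hji'
  have hσo : IsOrthonormal fun i => e (σ i) := he.orthonormal.comp hσ
  have hRn : extNorm (wedgeSkip u p - α • wedgeSeq u (p + 1)) ^ 2 =
      extNorm (wedgeSeq u p) ^ 2 * ‖u (p + 1) ⬝ᵥ star (e iq)‖ ^ 2 := by
    rw [hR, extNorm_smul_sq, hσo.extNorm_ιMulti, he.extNorm_wedgeSeq_sq (by omega : p ≤ m), norm_mul,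
      norm_prod, mul_pow, Finset.prod_pow]
    ring
  have hRH : extNorm (interiorProduct (wedgeSkip u p - α • wedgeSeq u (p + 1)) H) ^ 2 =
      extNorm (wedgeSeq u p) ^ 2 * ‖u (p + 1) ⬝ᵥ star (e iq)‖ ^ 2 *
        (∑ i : Fin p, ‖e (Fin.castLE (by omega) i) ⬝ᵥ star H‖ ^ 2 + ‖e iq ⬝ᵥ star H‖ ^ 2) := by
    rw [hR, interiorProduct_smul, extNorm_smul_sq, hσo.extNorm_interiorProduct_sq,
      he.extNorm_wedgeSeq_sq (by omega : p ≤ m), norm_mul, norm_prod, mul_pow, Finset.prod_pow,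
      Fin.sum_univ_castSucc]
    simp [σ]
  have hXn : extNorm (wedgeSeq u (p + 1)) ^ 2 =
      extNorm (wedgeSeq u p) ^ 2 * ‖u p ⬝ᵥ star (e ip)‖ ^ 2 := by
    rw [he.extNorm_wedgeSeq_sq (by omega : p + 1 ≤ m), he.extNorm_wedgeSeq_sq (by omega : p ≤ m),
      Fin.prod_univ_castSucc]
    rfl
  have hZn : extNorm (wedgeSeq u (p + 2)) ^ 2 =
      extNorm (wedgeSeq u (p + 1)) ^ 2 * ‖u (p + 1) ⬝ᵥ star (e iq)‖ ^ 2 := by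
    rw [he.extNorm_wedgeSeq_sq (by omega : p + 1 ≤ m), he.extNorm_wedgeSeq_sq (by omega : p + 2 ≤ m),
      Fin.prod_univ_castSucc]
    rfl
  have hXH := he.extNorm_interiorProduct_wedgeSeq_sq (by omega : p + 1 ≤ m) H
  have hZH := he.extNorm_interiorProduct_wedgeSeq_sq (by omega : p + 1 + 1 ≤ m) H
  rw [Fin.sum_univ_castSucc] at hXH hZH
  rw [Fin.sum_univ_castSucc] at hZH
  refine ⟨α, ?_, ?_, ?_⟩
  · rw [hR, he.wedgeSeq_eq (by omega : p + 1 ≤ m), herm_smul_left, herm_smul_right,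
      herm_ιMulti_ιMulti]
    refine mul_eq_zero_of_right _ (mul_eq_zero_of_right _ ?_)
    refine Matrix.det_eq_zero_of_row_eq_zero (Fin.last p) fun j => ?_
    rw [Matrix.of_apply, he.orthonormal, if_neg]
    simp only [σ, Fin.snoc_last, iq, Fin.ext_iff, Fin.val_castLE]
    omega
  · rw [hRn, hXn, hZn, hXn]
    ring
  · change _ = _ * (_ + ‖e ip ⬝ᵥ star H‖ ^ 2) at hXH
    change _ = _ * (_ + ‖e ip ⬝ᵥ star H‖ ^ 2 + ‖e iq ⬝ᵥ star H‖ ^ 2) at hZH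
    change extNorm (wedgeSeq u p) ^ 2 * extNorm (interiorProduct (wedgeSeq u (p + 1 + 1)) H) ^ 2 ≤ _
    have hZn' : extNorm (wedgeSeq u (p + 1 + 1)) ^ 2 = _ := hZn
    rw [hRn, hRH, hXH, hZH, hZn', hXn]
    have hs : (0 : ℝ) ≤ ∑ i : Fin p, ‖e (Fin.castLE (by omega) i) ⬝ᵥ star H‖ ^ 2 :=
      Finset.sum_nonneg fun _ _ => sq_nonneg _
    change _ * (_ * _ * _ * ((∑ i : Fin p, ‖e (Fin.castLE (by omega) i) ⬝ᵥ star H‖ ^ 2) + _ + _)) ≤ _ +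
      _ * (_ * _ * ((∑ i : Fin p, ‖e (Fin.castLE (by omega) i) ⬝ᵥ star H‖ ^ 2) + _))
    generalize (∑ i : Fin p, ‖e (Fin.castLE (by omega) i) ⬝ᵥ star H‖ ^ 2) = S at *
    -- With `x`, `y` the squared components of `H` along `e_p`, `e_{p+1}`, the claim is `S + x + y ≤
    -- (S + y) + (S + x)` up to a common factor; the slack is this multiple of `S`.
    have : 0 ≤ extNorm (wedgeSeq u p) ^ 2 * extNorm (wedgeSeq u p) ^ 2 *
      ‖u p ⬝ᵥ star (e ip)‖ ^ 2 * ‖u (p + 1) ⬝ᵥ star (e iq)‖ ^ 2 * S := by positivity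
    nlinarith [this]

end Frames

end HolCurve

namespace HolCurve

/-! ### First and second Wirtinger derivatives of real functions -/

section Wirtinger

open Filter Topology

/-- `u` is of class `C²` at `z`, with `∂u/∂z = D` and `∂²u/∂z∂z̄ = L`. -/
structure HasWirtinger (u : ℂ → ℝ) (z : ℂ) (D : ℂ) (L : ℝ) : Prop where
  contDiffAt : ContDiffAt ℝ 2 u z
  fderiv_apply : ∀ ξ : ℂ, fderiv ℝ u z ξ = 2 * (D * ξ).re
  laplacian_eq : Laplacian.laplacian u z = 4 * L

theorem laplacian_eq_fderiv_fderiv {u : ℂ → ℝ} {z : ℂ} (hu : ContDiffAt ℝ 2 u z) :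
    Laplacian.laplacian u z = fderiv ℝ (fun w => fderiv ℝ u w 1) z 1 +
      fderiv ℝ (fun w => fderiv ℝ u w Complex.I) z Complex.I := by
  have hd : DifferentiableAt ℝ (fderiv ℝ u) z :=
    (hu.fderiv_right (m := 1) (by norm_num)).differentiableAt one_ne_zero
  have h : ∀ ξ : ℂ, fderiv ℝ (fun w => fderiv ℝ u w ξ) z ξ = fderiv ℝ (fderiv ℝ u) z ξ ξ := by
    intro ξ
    rw [fderiv_clm_apply hd (differentiableAt_const ξ)]
    simp
  rw [h, h, InnerProductSpace.laplacian_eq_iteratedFDeriv_complexPlane]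
  simp [iteratedFDeriv_two_apply]

namespace HasWirtinger

variable {u v : ℂ → ℝ} {z D E : ℂ} {L K : ℝ}

theorem ddc_eq (h : HasWirtinger u z D L) : ddc u z = L := by
  rw [ddc, h.laplacian_eq]
  ring

theorem congr (h : HasWirtinger u z D L) (huv : v =ᶠ[𝓝 z] u) : HasWirtinger v z D L where
  contDiffAt := h.contDiffAt.congr_of_eventuallyEq huv
  fderiv_apply ξ := by rw [huv.fderiv_eq, h.fderiv_apply]
  laplacian_eq := by
    rw [(InnerProductSpace.laplacian_congr_nhds huv).eq_of_nhds, h.laplacian_eq]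

theorem add (h : HasWirtinger u z D L) (k : HasWirtinger v z E K) :
    HasWirtinger (fun w => u w + v w) z (D + E) (L + K) where
  contDiffAt := h.contDiffAt.add k.contDiffAt
  fderiv_apply ξ := by
    rw [fderiv_fun_add (h.contDiffAt.differentiableAt two_ne_zero)
      (k.contDiffAt.differentiableAt two_ne_zero), add_apply, h.fderiv_apply,
      k.fderiv_apply, add_mul, Complex.add_re]
    ring
  laplacian_eq := by
    have := h.contDiffAt.laplacian_add k.contDiffAt
    change Laplacian.laplacian (u + v) z = _
    rw [this, h.laplacian_eq, k.laplacian_eq]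
    ring

theorem const_mul (c : ℝ) (h : HasWirtinger u z D L) :
    HasWirtinger (fun w => c * u w) z (c * D) (c * L) where
  contDiffAt := contDiffAt_const.mul h.contDiffAt
  fderiv_apply ξ := by
    rw [fderiv_const_mul (h.contDiffAt.differentiableAt two_ne_zero),
      smul_apply, h.fderiv_apply, mul_assoc, Complex.re_ofReal_mul, smul_eq_mul]
    ring
  laplacian_eq := by
    have := InnerProductSpace.laplacian_smul c h.contDiffAt
    change Laplacian.laplacian (c • u) z = _
    rw [this, h.laplacian_eq, smul_eq_mul]
    ring

theorem const (c : ℝ) (z : ℂ) : HasWirtinger (fun _ => c) z 0 0 where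
  contDiffAt := contDiffAt_const
  fderiv_apply ξ := by simp
  laplacian_eq := by
    rw [laplacian_eq_fderiv_fderiv contDiffAt_const]
    simp

theorem sum {ι : Type*} (s : Finset ι) {u : ι → ℂ → ℝ} {D : ι → ℂ} {L : ι → ℝ}
    (h : ∀ i ∈ s, HasWirtinger (u i) z (D i) (L i)) :
    HasWirtinger (fun w => ∑ i ∈ s, u i w) z (∑ i ∈ s, D i) (∑ i ∈ s, L i) := by
  classical
  induction s using Finset.induction_on with
  | empty => simpa using const 0 z
  | insert i s hi ih =>
    simp only [Finset.sum_insert hi]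
    exact (h i (Finset.mem_insert_self _ _)).add
      (ih fun j hj => h j (Finset.mem_insert_of_mem hj))

theorem sub (h : HasWirtinger u z D L) (k : HasWirtinger v z E K) :
    HasWirtinger (fun w => u w - v w) z (D - E) (L - K) := by
  have := h.add (k.const_mul (-1))
  convert this using 1
  · funext w; ring
  · push_cast; ring
  · ring

/-- The term `‖D‖²` is the reason why first derivatives are carried along with the Laplacian. -/
theorem log (h : HasWirtinger u z D L) (hz : u z ≠ 0) :
    HasWirtinger (fun w => Real.log (u w)) z (D / u z) (L / u z - ‖D‖ ^ 2 / u z ^ 2) := by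
  have hc : ContDiffAt ℝ 2 (fun w => Real.log (u w)) z := h.contDiffAt.log hz
  have hd : DifferentiableAt ℝ u z := h.contDiffAt.differentiableAt two_ne_zero
  have hev : ∀ᶠ w in 𝓝 z, u w ≠ 0 ∧ DifferentiableAt ℝ u w := by
    refine (hd.continuousAt.eventually_ne hz).and ?_
    filter_upwards [h.contDiffAt.eventually (by simp)] with w hw
    exact hw.differentiableAt two_ne_zero
  have hf : ∀ ξ : ℂ, (fun w => fderiv ℝ (fun w => Real.log (u w)) w ξ) =ᶠ[𝓝 z]
      fun w => (u w)⁻¹ * fderiv ℝ u w ξ := by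
    intro ξ
    filter_upwards [hev] with w hw
    rw [fderiv.log hw.2 hw.1]
    simp
  refine ⟨hc, fun ξ => ?_, ?_⟩
  · rw [(hf ξ).eq_of_nhds, h.fderiv_apply, div_mul_eq_mul_div, Complex.div_ofReal_re]
    field_simp
  · have hd2 : DifferentiableAt ℝ (fderiv ℝ u) z :=
      (h.contDiffAt.fderiv_right (m := 1) (by norm_num)).differentiableAt one_ne_zero
    have h2 : ∀ ξ : ℂ, fderiv ℝ (fun w => fderiv ℝ (fun w => Real.log (u w)) w ξ) z ξ =
        (u z)⁻¹ * fderiv ℝ (fun w => fderiv ℝ u w ξ) z ξ - (fderiv ℝ u z ξ) ^ 2 / u z ^ 2 := by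
      intro ξ
      have hinv : HasFDerivAt (fun w => (u w)⁻¹) ((-(u z ^ 2)⁻¹) • fderiv ℝ u z) z :=
        (hasDerivAt_inv hz).comp_hasFDerivAt z hd.hasFDerivAt
      rw [(hf ξ).fderiv_eq, fderiv_fun_mul
        hinv.differentiableAt
        (hd2.clm_apply (differentiableAt_const ξ)),
        hinv.fderiv]
      simp
      field_simp
      ring
    rw [laplacian_eq_fderiv_fderiv hc, h2, h2]
    have h3 := h.laplacian_eq
    rw [laplacian_eq_fderiv_fderiv h.contDiffAt] at h3
    have h4 : ‖D‖ ^ 2 = D.re ^ 2 + D.im ^ 2 := by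
      rw [← Complex.normSq_eq_norm_sq, Complex.normSq_apply]; ring
    rw [h.fderiv_apply, h.fderiv_apply, h4]
    simp only [mul_one, Complex.mul_re, Complex.I_re, Complex.I_im, mul_zero, zero_sub]
    have h5 : fderiv ℝ (fun w => fderiv ℝ u w 1) z 1 =
      4 * L - fderiv ℝ (fun w => fderiv ℝ u w Complex.I) z Complex.I := by linarith
    rw [h5]
    field_simp
    ring

theorem norm_sq {g : ℂ → ℂ} (hg : Differentiable ℂ g) (z : ℂ) :
    HasWirtinger (fun w => ‖g w‖ ^ 2) z (deriv g z * starRingEnd ℂ (g z)) (‖deriv g z‖ ^ 2) := by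
  have hgc : ContDiff ℝ 2 g := (hg.contDiff (n := 2)).restrict_scalars ℝ
  have hc : ContDiffAt ℝ 2 (fun w => ‖g w‖ ^ 2) z := (hgc.norm_sq ℝ).contDiffAt
  have hfd : ∀ {k : ℂ → ℂ}, Differentiable ℂ k → ∀ w,
      HasFDerivAt k (deriv k w • (1 : ℂ →L[ℝ] ℂ)) w := fun hk w =>
    (hk w).hasDerivAt.complexToReal_fderiv
  have hf : ∀ w ξ : ℂ, fderiv ℝ (fun w => ‖g w‖ ^ 2) w ξ =
      2 * (starRingEnd ℂ (g w) * (deriv g w * ξ)).re := by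
    intro w ξ
    rw [(hfd hg w).norm_sq.fderiv]
    simp [Complex.inner]
    ring
  refine ⟨hc, fun ξ => ?_, ?_⟩
  · rw [hf]
    congr 2
    ring
  · have hg' : Differentiable ℂ (deriv g) := by
      have := (hg.contDiff (n := 2))
      exact (contDiff_succ_iff_deriv (n := 1).1 this).2.2.differentiable one_ne_zero
    have h2 : ∀ ξ : ℂ, fderiv ℝ (fun w => fderiv ℝ (fun w => ‖g w‖ ^ 2) w ξ) z ξ =
        2 * (starRingEnd ℂ (deriv g z * ξ) * (deriv g z * ξ) +
          starRingEnd ℂ (g z) * (deriv (deriv g) z * ξ * ξ)).re := by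
      intro ξ
      simp only [hf]
      have h3 := (((Complex.conjCLE.hasFDerivAt.comp z (hfd hg z)).mul
        ((hfd hg' z).mul_const ξ)))
      have h4 := (Complex.reCLM.hasFDerivAt.comp z h3).const_mul 2
      have h5 := h4.fderiv
      simp only [Function.comp_def] at h5
      change fderiv ℝ (fun w => 2 * (starRingEnd ℂ (g w) * (deriv g w * ξ)).re) z = _ at h5
      rw [h5]
      simp
      ring
    rw [laplacian_eq_fderiv_fderiv hc, h2, h2]
    have h4 : ‖deriv g z‖ ^ 2 = (deriv g z).re ^ 2 + (deriv g z).im ^ 2 := by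
      rw [← Complex.normSq_eq_norm_sq, Complex.normSq_apply]; ring
    rw [h4]
    simp
    ring

end HasWirtinger

theorem ddc_norm_sq (z : ℂ) : ddc (fun w => ‖w‖ ^ 2) z = 1 := by
  have := HasWirtinger.norm_sq (g := fun w => w) differentiable_id z
  rw [this.ddc_eq]
  simp

end Wirtinger

end HolCurve

namespace HolCurve

/-! ### Holomorphic curves in exterior powers -/

section Curves

open Filter Topology Matrix

variable {m r k : ℕ}

/-- `G` is an entire curve in `⋀ʳ ℂᵐ` with derivative `G'`. -/
def HasExtDeriv (G G' : ℂ → ExtPow m r) : Prop :=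
  ∀ s z, HasDerivAt (fun w => (extBasis m r).repr (G w) s) ((extBasis m r).repr (G' z) s) z

namespace HasExtDeriv

variable {G G' : ℂ → ExtPow m r}

theorem wirtinger_extNorm_sq (h : HasExtDeriv G G') (z : ℂ) :
    HasWirtinger (fun w => extNorm (G w) ^ 2) z (herm (G' z) (G z)) (extNorm (G' z) ^ 2) := by
  have h1 : ∀ s, HasWirtinger (fun w => ‖(extBasis m r).repr (G w) s‖ ^ 2) z
      ((extBasis m r).repr (G' z) s * starRingEnd ℂ ((extBasis m r).repr (G z) s))
      (‖(extBasis m r).repr (G' z) s‖ ^ 2) := by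
    intro s
    have := HasWirtinger.norm_sq (fun w => (h s w).differentiableAt) z
    rwa [(h s z).deriv] at this
  have h2 := HasWirtinger.sum Finset.univ fun s _ => h1 s
  simp only [← extNorm_sq] at h2
  exact h2

theorem map (h : HasExtDeriv G G') (T : ExtPow m r →ₗ[ℂ] ExtPow m k) :
    HasExtDeriv (fun w => T (G w)) fun w => T (G' w) := by
  have hT : ∀ (A : ExtPow m r) (s), (extBasis m k).repr (T A) s =
      ∑ t, (extBasis m r).repr A t * (extBasis m k).repr (T (extBasis m r t)) s := by
    intro A s
    conv_lhs => rw [← (extBasis m r).sum_repr A]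
    simp only [map_sum, map_smul, Finsupp.coe_finsetSum, Finset.sum_apply, Finsupp.smul_apply,
      smul_eq_mul]
  intro s z
  rw [hT (G' z) s, funext fun w => hT (G w) s]
  exact HasDerivAt.fun_sum fun t _ => (h t z).mul_const _

theorem interiorProduct {G G' : ℂ → ExtPow m (r + 1)} (h : HasExtDeriv G G') (H : Fin m → ℂ) :
    HasExtDeriv (fun w => interiorProduct (G w) H) fun w => HolCurve.interiorProduct (G' w) H :=
  h.map
    { toFun := fun A => HolCurve.interiorProduct A H
      map_add' := fun A B => interiorProduct_add A B H
      map_smul' := fun c A => interiorProduct_smul c A H }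

end HasExtDeriv

/-- The coordinates of `u₀ ∧ ⋯ ∧ u_{r-1}`, as a continuous multilinear map. -/
noncomputable def wedgeCoord (s : Set.powersetCard (Fin m) r) :
    ContinuousMultilinearMap ℂ (fun _ : Fin r => Fin m → ℂ) ℂ where
  toMultilinearMap := ((extBasis m r).coord s).compMultilinearMap
    (exteriorPower.ιMulti ℂ r).toMultilinearMap
  cont := by
    have : (fun w : Fin r → Fin m → ℂ =>
        (extBasis m r).repr (exteriorPower.ιMulti ℂ r w) s) = fun w =>
          (Matrix.of fun i j => w i (Set.powersetCard.ofFinEmbEquiv.symm s j)).det :=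
      funext fun w => extBasis_repr_ιMulti w s
    change Continuous fun w : Fin r → Fin m → ℂ =>
        (extBasis m r).repr (exteriorPower.ιMulti ℂ r w) s
    rw [this]
    refine Continuous.matrix_det ?_
    exact continuous_matrix fun i j => by
      simp only [Matrix.of_apply]
      fun_prop

theorem wedgeCoord_apply (s : Set.powersetCard (Fin m) r) (w : Fin r → Fin m → ℂ) :
    wedgeCoord s w = (extBasis m r).repr (exteriorPower.ιMulti ℂ r w) s := rfl

/-- `(F ∧ F' ∧ ⋯ ∧ F^{(p)})' = F ∧ ⋯ ∧ F^{(p-1)} ∧ F^{(p+1)}`. -/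
theorem hasExtDeriv_wedgeSeq {U : ℂ → ℕ → Fin m → ℂ}
    (hU : ∀ z l i, HasDerivAt (fun w => U w l i) (U z (l + 1) i) z) (p : ℕ) :
    HasExtDeriv (fun w => wedgeSeq (U w) (p + 1)) fun w => wedgeSkip (U w) p := by
  intro s z
  have h1 : HasDerivAt (fun w => fun l : Fin (p + 1) => U w l) (fun l => U z (l + 1)) z :=
    hasDerivAt_pi.2 fun l => hasDerivAt_pi.2 fun i => hU z l i
  have h2 := ((wedgeCoord s).hasFDerivAt (fun l : Fin (p + 1) => U z l)).comp_hasDerivAt z h1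
  rw [ContinuousMultilinearMap.linearDeriv_apply, Finset.sum_eq_single (Fin.last p)] at h2
  · exact h2
  -- Differentiating any factor but the last repeats the next factor, so only the last term of the
  -- product rule survives.
  · intro i _ hi
    obtain ⟨j, rfl⟩ := Fin.exists_castSucc_eq.2 hi
    rw [wedgeCoord_apply, AlternatingMap.map_eq_zero_of_eq _ _ (i := j.castSucc) (j := j.succ)]
    · simp
    · rw [Function.update_self, Function.update_of_ne (Fin.castSucc_lt_succ).ne']
      rfl
    · exact (Fin.castSucc_lt_succ).ne
  · simp

end Curves

end HolCurve

namespace HolCurve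

/-! ### Curvature of the derived curves and the inequality for one contact function. -/

section ContactInequality

open Filter Topology

variable {m r : ℕ}

theorem extNorm_add_smul_sq (A B : ExtPow m r) (α : ℂ) :
    extNorm (A + α • B) ^ 2 = extNorm A ^ 2 + 2 * (starRingEnd ℂ α * herm A B).re +
      ‖α‖ ^ 2 * extNorm B ^ 2 := by
  have h1 : herm (A + α • B) (A + α • B) = herm A A + (starRingEnd ℂ α * herm A B +
      starRingEnd ℂ (starRingEnd ℂ α * herm A B)) + (α * starRingEnd ℂ α) * herm B B := by
    rw [herm_add_left, herm_add_right, herm_add_right, herm_smul_left, herm_smul_left,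
      herm_smul_right, herm_smul_right, map_mul, Complex.conj_conj, herm_conj_symm]
    ring
  rw [extNorm_sq_eq_re, h1, Complex.mul_conj', herm_self A, herm_self B]
  simp only [Complex.add_re, Complex.ofReal_re, Complex.conj_re]
  norm_cast
  ring

theorem norm_herm_sq_le (A B : ExtPow m r) :
    ‖herm A B‖ ^ 2 ≤ extNorm A ^ 2 * extNorm B ^ 2 := by
  have h1 : ‖herm A B‖ ≤ ∑ s, ‖(extBasis m r).repr A s‖ * ‖(extBasis m r).repr B s‖ := by
    refine (norm_sum_le _ _).trans (Finset.sum_le_sum fun s _ => ?_)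
    rw [norm_mul, RCLike.norm_conj]
  calc ‖herm A B‖ ^ 2
      ≤ (∑ s, ‖(extBasis m r).repr A s‖ * ‖(extBasis m r).repr B s‖) ^ 2 := by gcongr
    _ ≤ _ := by
      rw [extNorm_sq, extNorm_sq]
      exact Finset.sum_mul_sq_le_sq_mul_sq _ _ _

/-- The Wirtinger derivatives of `log |G|²`, in terms of `G' - αG`. -/
theorem HasExtDeriv.wirtinger_log {G G' : ℂ → ExtPow m r} (h : HasExtDeriv G G') {z : ℂ}
    (hz : G z ≠ 0) {R : ExtPow m r} {α : ℂ} (hR : G' z = R + α • G z) :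
    HasWirtinger (fun w => Real.log (extNorm (G w) ^ 2)) z
      (α + herm R (G z) / (extNorm (G z) ^ 2 : ℝ))
      (extNorm R ^ 2 / extNorm (G z) ^ 2 - ‖herm R (G z)‖ ^ 2 / (extNorm (G z) ^ 2) ^ 2) := by
  have hpos : 0 < extNorm (G z) ^ 2 := pow_pos (extNorm_pos hz) 2
  have hne : ((extNorm (G z) ^ 2 : ℝ) : ℂ) ≠ 0 := by exact_mod_cast hpos.ne'
  have h1 := (h.wirtinger_extNorm_sq z).log hpos.ne'
  convert h1 using 1
  · rw [hR, herm_add_left, herm_smul_left, herm_self]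
    field_simp
    ring
  · rw [hR, extNorm_add_smul_sq, herm_add_left, herm_smul_left, herm_self]
    set N := extNorm (G z) ^ 2
    set c := herm R (G z)
    have h2 : ‖c + α * (N : ℂ)‖ ^ 2 = ‖c‖ ^ 2 + 2 * N * (starRingEnd ℂ α * c).re +
        ‖α‖ ^ 2 * N ^ 2 := by
      simp only [← Complex.normSq_eq_norm_sq, Complex.normSq_apply, Complex.add_re, Complex.add_im,
        Complex.mul_re, Complex.mul_im, Complex.ofReal_re, Complex.ofReal_im, Complex.conj_re,
        Complex.conj_im]
      ring
    rw [h2]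
    field_simp
    ring

/-- `Ω_p = |F_{p-1}|² |F_{p+1}|² / |F_p|⁴`. -/
noncomputable def curvature (u : ℕ → Fin m → ℂ) (p : ℕ) : ℝ :=
  extNorm (wedgeSeq u p) ^ 2 * extNorm (wedgeSeq u (p + 2)) ^ 2 /
    (extNorm (wedgeSeq u (p + 1)) ^ 2) ^ 2

theorem curvature_nonneg (u : ℕ → Fin m → ℂ) (p : ℕ) : 0 ≤ curvature u p := by
  unfold curvature
  positivity

/-- The contact function `φ_p` of `F` and the vector `H`. -/
noncomputable def contactRatio (u : ℕ → Fin m → ℂ) (H : Fin m → ℂ) (p : ℕ) : ℝ :=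
  extNorm (interiorProduct (wedgeSeq u (p + 1)) H) ^ 2 / extNorm (wedgeSeq u (p + 1)) ^ 2

theorem contactRatio_nonneg (u : ℕ → Fin m → ℂ) (H : Fin m → ℂ) (p : ℕ) :
    0 ≤ contactRatio u H p := by
  unfold contactRatio
  positivity

variable {U : ℂ → ℕ → Fin m → ℂ}

/-- The residue `R = F_p' - αF_p` is orthogonal to `F_p`, so the gradient term in the formula for
the logarithm vanishes and `|R|² / |F_p|²` is left. -/
theorem wirtinger_log_extNorm_wedgeSeq
    (hU : ∀ z l i, HasDerivAt (fun w => U w l i) (U z (l + 1) i) z) {p : ℕ} (hp : p + 2 ≤ m)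
    {z : ℂ} (hX : wedgeSeq (U z) (p + 1) ≠ 0) :
    ∃ D, HasWirtinger (fun w => Real.log (extNorm (wedgeSeq (U w) (p + 1)) ^ 2)) z D
      (curvature (U z) p) := by
  obtain ⟨α, h1, h2, -⟩ := exists_orthogonal_residue (U z) hp hX 0
  have h := (hasExtDeriv_wedgeSeq hU p).wirtinger_log hX
    (R := wedgeSkip (U z) p - α • wedgeSeq (U z) (p + 1)) (α := α) (by simp)
  have hpos : 0 < extNorm (wedgeSeq (U z) (p + 1)) ^ 2 := pow_pos (extNorm_pos hX) 2
  have hK : extNorm (wedgeSkip (U z) p - α • wedgeSeq (U z) (p + 1)) ^ 2 /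
      extNorm (wedgeSeq (U z) (p + 1)) ^ 2 -
      ‖herm (wedgeSkip (U z) p - α • wedgeSeq (U z) (p + 1)) (wedgeSeq (U z) (p + 1))‖ ^ 2 /
        (extNorm (wedgeSeq (U z) (p + 1)) ^ 2) ^ 2 = curvature (U z) p := by
    rw [h1, curvature, ← h2, norm_zero, sq (extNorm (wedgeSeq (U z) (p + 1)) ^ 2),
      mul_div_mul_right _ _ hpos.ne']
    simp
  rw [hK] at h
  exact ⟨_, h⟩

/-- Here `h = |F_p|²`, `g = |F_p ∨ H|²`, `R = |R_p|²` and `ρ = |R_p ∨ H|²` for the residue `R_p`, `c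
= |⟨R_p ∨ H, F_p ∨ H⟩|²`, and `A = |F_{p-1}|² |F_{p+1} ∨ H|²`. Cauchy–Schwarz (`hc`) makes `ρ / g -
c / g²` nonnegative, so its factor `1 / L` may be lowered to `1 / L²`; the `c`-terms then cancel and
`hA` applies. -/
theorem contact_real_inequality {h g L A R ρ c : ℝ} (hh : 0 < h) (hg : 0 < g) (hL : 1 ≤ L)
    (hR : 0 ≤ R) (hc : c ≤ ρ * g) (hA : A ≤ ρ * h + R * g) :
    A / h ^ 2 / (g / h * L ^ 2) - 2 / L * (R / h) ≤
      -((R / h - (ρ / g - c / g ^ 2)) / L - c / g ^ 2 / L ^ 2) := by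
  have hL0 : 0 < L := by linarith
  have h1 : A / h ^ 2 / (g / h * L ^ 2) ≤ (ρ / g + R / h) / L ^ 2 := by
    have : A / h ^ 2 / (g / h * L ^ 2) = A / (h * g) / L ^ 2 := by field_simp
    rw [this]
    have h2 : ρ / g + R / h = (ρ * h + R * g) / (h * g) := by field_simp
    rw [h2]
    gcongr
  have h2 : 0 ≤ (R / h) / L ^ 2 * (L - 1) :=
    mul_nonneg (by positivity) (by linarith)
  have h3 : 0 ≤ (ρ / g - c / g ^ 2) / L ^ 2 * (L - 1) := by
    refine mul_nonneg (div_nonneg ?_ (by positivity)) (by linarith)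
    have : ρ / g - c / g ^ 2 = (ρ * g - c) / g ^ 2 := by field_simp
    rw [this]
    exact div_nonneg (by linarith) (by positivity)
  have e2 : (R / h) / L ^ 2 * (L - 1) = R / h / L - R / h / L ^ 2 := by field_simp
  have e3 : (ρ / g - c / g ^ 2) / L ^ 2 * (L - 1) =
      (ρ / g - c / g ^ 2) / L - (ρ / g - c / g ^ 2) / L ^ 2 := by field_simp
  rw [e2] at h2
  rw [e3] at h3
  have e4 : (ρ / g - c / g ^ 2) / L ^ 2 = ρ / g / L ^ 2 - c / g ^ 2 / L ^ 2 := by ring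
  have e5 : (ρ / g + R / h) / L ^ 2 = ρ / g / L ^ 2 + R / h / L ^ 2 := by ring
  have e6 : (R / h - (ρ / g - c / g ^ 2)) / L = R / h / L - (ρ / g - c / g ^ 2) / L := by ring
  have e7 : 2 / L * (R / h) = 2 * (R / h / L) := by ring
  rw [e6, e7]
  linarith

/-- The main inequality for the contact functions:
`dd^c log (1 / log (δ / φ_p)) ≥ (φ_{p+1} / (φ_p log² (δ / φ_p)) - 1 / log - 1 / log²) Ω_p`. -/
theorem exists_wirtinger_log_log
    (hU : ∀ z l i, HasDerivAt (fun w => U w l i) (U z (l + 1) i) z) {p : ℕ} (hp : p + 2 ≤ m)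
    {H : Fin m → ℂ} {z : ℂ} (hG : contactRatio (U z) H p ≠ 0)
    {δ : ℝ} (hδ : 0 < δ) (hL : 1 ≤ Real.log (δ / contactRatio (U z) H p)) :
    ∃ D K, HasWirtinger (fun w => Real.log (Real.log (δ / contactRatio (U w) H p))) z D K ∧
      contactRatio (U z) H (p + 1) / (contactRatio (U z) H p *
          Real.log (δ / contactRatio (U z) H p) ^ 2) * curvature (U z) p -
        (2 / Real.log (δ / contactRatio (U z) H p)) * curvature (U z) p ≤ -K := by
  have hG0 : interiorProduct (wedgeSeq (U z) (p + 1)) H ≠ 0 := by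
    intro h0
    apply hG
    simp [contactRatio, h0, (extNorm_eq_zero _).2]
  have hX : wedgeSeq (U z) (p + 1) ≠ 0 := by
    intro h0
    apply hG
    simp [contactRatio, h0, (extNorm_eq_zero _).2]
  obtain ⟨α, h1, h2, h3⟩ := exists_orthogonal_residue (U z) hp hX H
  have hdX := hasExtDeriv_wedgeSeq hU p
  have hdG := hdX.interiorProduct H
  have hwX := hdX.wirtinger_log hX
    (R := wedgeSkip (U z) p - α • wedgeSeq (U z) (p + 1)) (α := α) (by simp)
  -- The same `α` serves for `F_p` and for `F_p ∨ H`, so it cancels in the gradient of the logarithm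
  -- of their quotient.
  have hwG := hdG.wirtinger_log hG0
    (R := interiorProduct (wedgeSkip (U z) p - α • wedgeSeq (U z) (p + 1)) H) (α := α) (by
      rw [← interiorProduct_smul, ← interiorProduct_add, sub_add_cancel])
  have hev : (fun w => Real.log (δ / contactRatio (U w) H p)) =ᶠ[𝓝 z] fun w =>
      (Real.log δ + Real.log (extNorm (wedgeSeq (U w) (p + 1)) ^ 2)) -
        Real.log (extNorm (interiorProduct (wedgeSeq (U w) (p + 1)) H) ^ 2) := by
    have c1 := (hdX.wirtinger_extNorm_sq z).contDiffAt.continuousAt.eventually_ne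
      (pow_pos (extNorm_pos hX) 2).ne'
    have c2 := (hdG.wirtinger_extNorm_sq z).contDiffAt.continuousAt.eventually_ne
      (pow_pos (extNorm_pos hG0) 2).ne'
    filter_upwards [c1, c2] with w hw1 hw2
    rw [contactRatio, div_div_eq_mul_div, Real.log_div (mul_ne_zero hδ.ne' hw1) hw2,
      Real.log_mul hδ.ne' hw1]
  have hw := ((((HasWirtinger.const (Real.log δ) z).add hwX).sub hwG).congr hev).log
    (by linarith)
  refine ⟨_, _, hw, ?_⟩
  have hhpos : 0 < extNorm (wedgeSeq (U z) (p + 1)) ^ 2 := pow_pos (extNorm_pos hX) 2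
  have hgpos : 0 < extNorm (interiorProduct (wedgeSeq (U z) (p + 1)) H) ^ 2 :=
    pow_pos (extNorm_pos hG0) 2
  have hcs := norm_herm_sq_le (interiorProduct (wedgeSkip (U z) p - α • wedgeSeq (U z) (p + 1)) H)
    (interiorProduct (wedgeSeq (U z) (p + 1)) H)
  have hφ : contactRatio (U z) H (p + 1) * curvature (U z) p =
      extNorm (interiorProduct (wedgeSeq (U z) (p + 2)) H) ^ 2 *
        extNorm (wedgeSeq (U z) p) ^ 2 / (extNorm (wedgeSeq (U z) (p + 1)) ^ 2) ^ 2 := by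
    -- If `F_{p+1} = 0`, then `contactRatio` is `0 / 0 = 0` and both sides vanish.
    by_cases hZ : wedgeSeq (U z) (p + 2) = 0
    · rw [contactRatio, curvature]
      rw [show wedgeSeq (U z) (p + 1 + 1) = 0 from hZ]
      have h0 : interiorProduct (0 : ExtPow m (p + 1 + 1)) H = 0 := by
        simpa using interiorProduct_smul 0 (0 : ExtPow m (p + 1 + 1)) H
      rw [(extNorm_eq_zero _).2 h0]
      simp
    · have hZpos : 0 < extNorm (wedgeSeq (U z) (p + 2)) ^ 2 := pow_pos (extNorm_pos hZ) 2
      rw [contactRatio, curvature]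
      change extNorm (interiorProduct (wedgeSeq (U z) (p + 2)) H) ^ 2 /
        extNorm (wedgeSeq (U z) (p + 2)) ^ 2 * _ = _
      generalize extNorm (wedgeSeq (U z) (p + 2)) ^ 2 = y at *
      field_simp
  have hΩ : curvature (U z) p =
      extNorm (wedgeSkip (U z) p - α • wedgeSeq (U z) (p + 1)) ^ 2 /
        extNorm (wedgeSeq (U z) (p + 1)) ^ 2 := by
    rw [curvature, ← h2]
    field_simp
  set L := Real.log (δ / contactRatio (U z) H p) with hLdef
  have hLpos : 0 < L := by linarith
  have hφΩ : contactRatio (U z) H (p + 1) / (contactRatio (U z) H p * L ^ 2) * curvature (U z) p =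
      contactRatio (U z) H (p + 1) * curvature (U z) p / (contactRatio (U z) H p * L ^ 2) := by
    ring
  rw [hφΩ, hφ, hΩ]
  have hn : ‖(0 : ℂ) + (α + herm (wedgeSkip (U z) p - α • wedgeSeq (U z) (p + 1))
      (wedgeSeq (U z) (p + 1)) / (extNorm (wedgeSeq (U z) (p + 1)) ^ 2 : ℝ)) -
      (α + herm (interiorProduct (wedgeSkip (U z) p - α • wedgeSeq (U z) (p + 1)) H)
        (interiorProduct (wedgeSeq (U z) (p + 1)) H) /
        (extNorm (interiorProduct (wedgeSeq (U z) (p + 1)) H) ^ 2 : ℝ))‖ ^ 2 =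
      ‖herm (interiorProduct (wedgeSkip (U z) p - α • wedgeSeq (U z) (p + 1)) H)
        (interiorProduct (wedgeSeq (U z) (p + 1)) H)‖ ^ 2 /
        (extNorm (interiorProduct (wedgeSeq (U z) (p + 1)) H) ^ 2) ^ 2 := by
    rw [h1, zero_div, add_zero, zero_add, sub_add_cancel_left, norm_neg, norm_div, div_pow,
      Complex.norm_real, Real.norm_of_nonneg hgpos.le]
  rw [hn, h1]
  simp only [norm_zero, ne_eq, OfNat.ofNat_ne_zero, not_false_eq_true, zero_pow, zero_div, sub_zero,
    zero_add]
  refine contact_real_inequality hhpos hgpos hL (by positivity) hcs ?_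
  rw [mul_comm]
  exact h3

end ContactInequality

end HolCurve

namespace HolCurve

/-! ### Dimension theory of finitely generated domains over a field -/

section DimensionTheory

/-- Induction on the number of variables: the contraction to one variable fewer is again maximal,
because polynomial rings over a field are Jacobson, and its height is one less. -/
theorem natCast_le_height_of_isMaximal {k : Type*} [Field k] (s : ℕ)
    (P : Ideal (MvPolynomial (Fin s) k)) [P.IsMaximal] : (s : ℕ∞) ≤ P.height := by
  induction s with
  | zero => simp
  | succ s ih =>
    let e := (MvPolynomial.finSuccEquiv k s).toRingEquiv
    have hP' : (P.map e).IsMaximal := Ideal.map_isMaximal_of_equiv e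
    have hmax : ((P.map e).under (MvPolynomial (Fin s) k)).IsMaximal :=
      Polynomial.isMaximal_comap_C_of_isJacobsonRing _
    have hlo : (P.map e).LiesOver ((P.map e).under (MvPolynomial (Fin s) k)) := ⟨rfl⟩
    have h1 := Polynomial.height_eq_height_add_one
      ((P.map e).under (MvPolynomial (Fin s) k)) (P.map e)
    rw [e.height_map P] at h1
    rw [h1]
    push_cast
    gcongr
    exact ih _

/-- Incomparability: contraction of primes along an integral map is strictly monotone. -/
theorem ringKrullDim_le_of_isIntegral {B A : Type*} [CommRing B] [CommRing A] [Algebra B A]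
    [Algebra.IsIntegral B A] : ringKrullDim A ≤ ringKrullDim B :=
  Order.krullDim_le_of_strictMono (PrimeSpectrum.comap (algebraMap B A)) fun P Q hPQ =>
    Ideal.IsIntegral.comap_lt_comap (R := B) (I := P.asIdeal) (J := Q.asIdeal) hPQ

/-- All maximal ideals of a finitely generated domain over a field have full height. -/
theorem ringKrullDim_le_height_of_isMaximal (k : Type*) {A : Type*} [Field k] [CommRing A]
    [IsDomain A] [Algebra k A] [Algebra.FiniteType k A] (P : Ideal A) [P.IsMaximal] :
    ringKrullDim A ≤ P.height := by
  -- Noether normalization; going down over the polynomial ring then shows that `P` has at least the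
  -- height of its contraction, which is maximal.
  obtain ⟨s, g, hinj, hfin⟩ := exists_finite_inj_algHom_of_fg k A
  let : Algebra (MvPolynomial (Fin s) k) A := g.toRingHom.toAlgebra
  have : Module.Finite (MvPolynomial (Fin s) k) A := hfin
  have : Algebra.IsIntegral (MvPolynomial (Fin s) k) A := inferInstance
  have : FaithfulSMul (MvPolynomial (Fin s) k) A :=
    (faithfulSMul_iff_algebraMap_injective _ _).2 hinj
  have : IsNoetherianRing A := IsNoetherianRing.of_finite
    (MvPolynomial (Fin s) k) A
  have hmax : (P.under (MvPolynomial (Fin s) k)).IsMaximal :=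
    Ideal.isMaximal_comap_of_isIntegral_of_isMaximal P
  have h1 := Ideal.height_eq_height_add_of_liesOver_of_hasGoingDown
    (P.under (MvPolynomial (Fin s) k)) P
  calc ringKrullDim A ≤ ringKrullDim (MvPolynomial (Fin s) k) := ringKrullDim_le_of_isIntegral
    _ = (s : WithBot ℕ∞) := by simp
    _ ≤ P.height := by
      rw [h1]
      exact_mod_cast (natCast_le_height_of_isMaximal s _).trans le_self_add

theorem ringKrullDim_quotient_le_of_le_radical {R : Type*} [CommRing R] {I J : Ideal R}
    (h : J ≤ I.radical) : ringKrullDim (R ⧸ I) ≤ ringKrullDim (R ⧸ J) := by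
  rw [ringKrullDim_quotient, ringKrullDim_quotient]
  have hsub : PrimeSpectrum.zeroLocus (R := R) I ⊆ PrimeSpectrum.zeroLocus (R := R) J := by
    intro P hP
    exact h.trans (P.isPrime.radical_le_iff.2 hP)
  exact Order.krullDim_le_of_strictMono (Set.inclusion hsub) fun _ _ h => h

/-- Cutting the affine variety of a prime ideal `I` by the equations `T = 0` which all hold at
some point of the variety lowers its dimension by at most the number of equations. -/
theorem ringKrullDim_quotient_le_add_encard (k : Type*) {R : Type*} [Field k] [CommRing R]
    [Algebra k R] [Algebra.FiniteType k R] {I P J : Ideal R} [I.IsPrime] [P.IsMaximal] (hIP : I ≤ P)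
    {T : Set R} (hT : T ⊆ P) (hJ : J ≤ (I ⊔ Ideal.span T).radical) :
    ringKrullDim (R ⧸ I) ≤ ringKrullDim (R ⧸ J) + T.encard := by
  have : IsNoetherianRing (R ⧸ I) := Algebra.FiniteType.isNoetherianRing k (R ⧸ I)
  have hker : RingHom.ker (Ideal.Quotient.mk I) ≤ P := by rwa [Ideal.mk_ker]
  have : (P.map (Ideal.Quotient.mk I)).IsMaximal :=
    (Ideal.map_eq_top_or_isMaximal_of_surjective _ Ideal.Quotient.mk_surjective
      ‹P.IsMaximal›).resolve_left fun h => by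
        have := congrArg (Ideal.comap (Ideal.Quotient.mk I)) h
        rw [Ideal.comap_map_of_surjective' _ Ideal.Quotient.mk_surjective, sup_eq_left.2 hker,
          Ideal.comap_top] at this
        exact ‹P.IsMaximal›.ne_top this
  have h1 := ringKrullDim_le_height_of_isMaximal k (P.map (Ideal.Quotient.mk I))
  -- Krull's height theorem at the point `P`, where `P` has full height in `R ⧸ I` by `h1`.
  have h2 := Ideal.height_le_ringKrullDim_quotient_add_encard
    (p := P.map (Ideal.Quotient.mk I)) (Ideal.Quotient.mk I '' T)
    (by rintro _ ⟨t, ht, rfl⟩; exact Ideal.mem_map_of_mem _ (hT ht))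
  rw [← Ideal.map_span] at h2
  rw [ringKrullDim_eq_of_ringEquiv (DoubleQuot.quotQuotEquivQuotSup I (Ideal.span T))] at h2
  refine h1.trans (h2.trans ?_)
  gcongr
  · exact ringKrullDim_quotient_le_of_le_radical hJ
  · exact_mod_cast Set.encard_image_le _ _

end DimensionTheory

end HolCurve

namespace HolCurve

/-! ### Hypersurface sections of a projective variety -/

section Projective

open MvPolynomial

variable {n : ℕ}

theorem eval_smul_of_isHomogeneous {P : MvPolynomial (Fin (n + 1)) ℂ} {e : ℕ}
    (hP : P.IsHomogeneous e) (c : ℂ) (x : Fin (n + 1) → ℂ) :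
    eval (c • x) P = c ^ e * eval x P := by
  rw [eval_eq, eval_eq, Finset.mul_sum]
  refine Finset.sum_congr rfl fun s hs => ?_
  have hd : ∑ i ∈ s.support, s i = e := by
    have := hP (mem_support_iff.1 hs)
    rw [Finsupp.weight_apply, Finsupp.sum] at this
    simpa using this
  simp only [Pi.smul_apply, smul_eq_mul, mul_pow, Finset.prod_mul_distrib, Finset.prod_pow_eq_pow_sum]
  rw [hd]
  ring

theorem mk_mem_hypersurface {P : MvPolynomial (Fin (n + 1)) ℂ} {e : ℕ} (hP : P.IsHomogeneous e)
    {x : Fin (n + 1) → ℂ} (hx : x ≠ 0) :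
    Projectivization.mk ℂ x hx ∈ hypersurface P ↔ eval x P = 0 := by
  obtain ⟨c, hc⟩ := Projectivization.exists_smul_eq_mk_rep ℂ x hx
  rw [hypersurface, Set.mem_ofPred_eq, ← hc, Units.smul_def, eval_smul_of_isHomogeneous hP]
  simp

theorem puncturedCone_nonempty_iff {W : Set (ProjSpace n)} :
    (puncturedCone W).Nonempty ↔ W.Nonempty := by
  constructor
  · rintro ⟨x, hx, h⟩
    exact ⟨_, h⟩
  · rintro ⟨p, hp⟩
    exact ⟨p.rep, p.rep_nonzero, by rwa [Projectivization.mk_rep]⟩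

theorem smul_mem_puncturedCone {W : Set (ProjSpace n)} {x : Fin (n + 1) → ℂ}
    (hx : x ∈ puncturedCone W) {c : ℂ} (hc : c ≠ 0) : c • x ∈ puncturedCone W := by
  obtain ⟨h0, h⟩ := hx
  refine ⟨smul_ne_zero hc h0, ?_⟩
  have : Projectivization.mk ℂ (c • x) (smul_ne_zero hc h0) = Projectivization.mk ℂ x h0 :=
    (Projectivization.mk_eq_mk_iff' ℂ _ _ _ _).2 ⟨c, rfl⟩
  rwa [this]

theorem mem_homIdeal {W : Set (ProjSpace n)} {P : MvPolynomial (Fin (n + 1)) ℂ} :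
    P ∈ homIdeal W ↔ ∀ x ∈ puncturedCone W, eval x P = 0 := by
  simp [homIdeal, mem_vanishingIdeal_iff, aeval_eq_eval]

theorem homIdeal_anti {W W' : Set (ProjSpace n)} (h : W ⊆ W') : homIdeal W' ≤ homIdeal W := by
  intro P hP
  rw [mem_homIdeal] at hP ⊢
  rintro x ⟨hx, hxW⟩
  exact hP x ⟨hx, h hxW⟩

/-- The vertex is a limit of points `t • x` of the punctured cone. -/
theorem eval_zero_of_mem_homIdeal {W : Set (ProjSpace n)} (hW : W.Nonempty)
    {P : MvPolynomial (Fin (n + 1)) ℂ} (hP : P ∈ homIdeal W) : eval 0 P = 0 := by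
  obtain ⟨x, hx⟩ := puncturedCone_nonempty_iff.2 hW
  have h1 : Continuous fun t : ℂ => eval (t • x) P :=
    (MvPolynomial.continuous_eval P).comp (continuous_id.smul continuous_const)
  have h2 := Continuous.ext_on (dense_compl_singleton (0 : ℂ)) h1 continuous_const
    fun t ht => mem_homIdeal.1 hP _ (smul_mem_puncturedCone hx ht)
  simpa using congrFun h2 0

theorem IsProjectiveVariety.nonempty {V : Set (ProjSpace n)} (hV : IsProjectiveVariety V) :
    V.Nonempty := by
  by_contra h
  refine hV.irreducible.ne_top (Ideal.eq_top_iff_one _ |>.2 (mem_homIdeal.2 fun x hx => ?_))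
  exact absurd (puncturedCone_nonempty_iff.1 ⟨x, hx⟩) h

theorem IsProjectiveVariety.exists_equations {V : Set (ProjSpace n)} (hV : IsProjectiveVariety V) :
    ∃ S : Set (MvPolynomial (Fin (n + 1)) ℂ),
      ∀ x, x ∈ puncturedCone V ↔ x ≠ 0 ∧ ∀ P ∈ S, eval x P = 0 := by
  obtain ⟨S, hS, hVS⟩ := hV.closed
  refine ⟨S, fun x => ?_⟩
  constructor
  · rintro ⟨hx, hxV⟩
    refine ⟨hx, fun P hP => ?_⟩
    rw [hVS] at hxV
    obtain ⟨e, he⟩ := hS P hP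
    exact (mk_mem_hypersurface he hx).1 (Set.mem_iInter₂.1 hxV P hP)
  · rintro ⟨hx, hP⟩
    refine ⟨hx, ?_⟩
    rw [hVS]
    refine Set.mem_iInter₂.2 fun P hPS => ?_
    obtain ⟨e, he⟩ := hS P hPS
    exact (mk_mem_hypersurface he hx).2 (hP P hPS)

variable {d q : ℕ}

theorem mem_puncturedCone_section {V : Set (ProjSpace n)} {Q : Fin q → HomPoly n d}
    {Γ : Finset (Fin q)} {x : Fin (n + 1) → ℂ} :
    x ∈ puncturedCone (V ∩ ⋂ j ∈ Γ, hypersurface (Q j : MvPolynomial (Fin (n + 1)) ℂ)) ↔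
      x ∈ puncturedCone V ∧ ∀ j ∈ Γ, eval x (Q j : MvPolynomial (Fin (n + 1)) ℂ) = 0 := by
  constructor
  · rintro ⟨hx, hxV, hxΓ⟩
    exact ⟨⟨hx, hxV⟩, fun j hj => (mk_mem_hypersurface (Q j).2 hx).1 (Set.mem_iInter₂.1 hxΓ j hj)⟩
  · rintro ⟨⟨hx, hxV⟩, hxΓ⟩
    exact ⟨hx, hxV, Set.mem_iInter₂.2 fun j hj => (mk_mem_hypersurface (Q j).2 hx).2 (hxΓ j hj)⟩

theorem eval_zero_homPoly (hd : 1 ≤ d) (P : HomPoly n d) :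
    eval 0 (P : MvPolynomial (Fin (n + 1)) ℂ) = 0 := by
  have := eval_smul_of_isHomogeneous P.2 0 (0 : Fin (n + 1) → ℂ)
  rw [zero_smul, zero_pow (by omega), zero_mul] at this
  exact this

/-- The affine dimension bound is applied at the vertex of the cone, where all forms of positive
degree vanish. Adding `0` to the cone keeps the bound valid even if the projective section is empty.
The Nullstellensatz compares the vanishing ideal with the radical of the equations. -/
theorem ringKrullDim_section_le (hd : 1 ≤ d) {V : Set (ProjSpace n)} (hV : IsProjectiveVariety V)
    (Q : Fin q → HomPoly n d) (Γ : Finset (Fin q)) {r : ℕ} (T : Fin r → HomPoly n d)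
    (hT : ∀ j ∈ Γ, (Q j : MvPolynomial (Fin (n + 1)) ℂ) ∈
      homIdeal V ⊔ Ideal.span (Set.range fun i => (T i : MvPolynomial (Fin (n + 1)) ℂ))) :
    ringKrullDim (MvPolynomial (Fin (n + 1)) ℂ ⧸ homIdeal V) ≤
      ringKrullDim (MvPolynomial (Fin (n + 1)) ℂ ⧸ vanishingIdeal ℂ (insert 0 (puncturedCone
        (V ∩ ⋂ j ∈ Γ, hypersurface (Q j : MvPolynomial (Fin (n + 1)) ℂ))))) + (r : ℕ) := by
  have := hV.irreducible
  have hmax : (vanishingIdeal ℂ {(0 : Fin (n + 1) → ℂ)}).IsMaximal :=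
    isMaximal_iff_eq_vanishingIdeal_singleton.2 ⟨0, rfl⟩
  have hmem : ∀ P, P ∈ vanishingIdeal ℂ {(0 : Fin (n + 1) → ℂ)} ↔ eval 0 P = 0 := by
    intro P
    simp [mem_vanishingIdeal_iff, aeval_eq_eval]
  obtain ⟨S, hS⟩ := hV.exists_equations
  refine (ringKrullDim_quotient_le_add_encard ℂ (P := vanishingIdeal ℂ {(0 : Fin (n + 1) → ℂ)})
    (I := homIdeal V) (T := Set.range fun i => (T i : MvPolynomial (Fin (n + 1)) ℂ))
    (fun P hP => (hmem P).2 (eval_zero_of_mem_homIdeal hV.nonempty hP)) ?_ ?_ (J := vanishingIdeal ℂ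
      (insert 0 (puncturedCone
        (V ∩ ⋂ j ∈ Γ, hypersurface (Q j : MvPolynomial (Fin (n + 1)) ℂ)))))).trans ?_
  · rintro _ ⟨i, rfl⟩
    exact (hmem _).2 (eval_zero_homPoly hd (T i))
  · rw [← vanishingIdeal_zeroLocus_eq_radical (K := ℂ)]
    refine vanishingIdeal_anti_mono fun x hx => ?_
    by_cases hx0 : x = 0
    · exact Or.inl hx0
    · right
      rw [mem_puncturedCone_section]
      have hx' : ∀ P ∈ homIdeal V ⊔ Ideal.span (Set.range fun i =>
          (T i : MvPolynomial (Fin (n + 1)) ℂ)), eval x P = 0 := by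
        intro P hP
        have := hx P hP
        rwa [aeval_eq_eval] at this
      refine ⟨(hS x).2 ⟨hx0, fun P hP => hx' P (Ideal.mem_sup_left (mem_homIdeal.2
        fun y hy => ((hS y).1 hy).2 P hP))⟩, fun j hj => hx' _ (hT j hj)⟩
  · gcongr
    have h1 : (Set.range fun i => (T i : MvPolynomial (Fin (n + 1)) ℂ)).encard ≤ (r : ℕ∞) := by
      rw [← Set.image_univ]
      refine (Set.encard_image_le _ _).trans ?_
      simp
    exact_mod_cast h1

/-- Excludes infinite dimension, for which `toNat` in `projDim` would give a default value. -/
theorem ringKrullDim_quotient_eq_bot_or_natCast (I : Ideal (MvPolynomial (Fin (n + 1)) ℂ)) :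
    ringKrullDim (MvPolynomial (Fin (n + 1)) ℂ ⧸ I) = ⊥ ∨
      ∃ k : ℕ, ringKrullDim (MvPolynomial (Fin (n + 1)) ℂ ⧸ I) = (k : ℕ) := by
  have h := ringKrullDim_quotient_le I
  rw [MvPolynomial.ringKrullDim_of_isNoetherianRing, ringKrullDim_eq_zero_of_field, zero_add] at h
  generalize ringKrullDim (MvPolynomial (Fin (n + 1)) ℂ ⧸ I) = x at h
  induction x with
  | bot => exact Or.inl rfl
  | coe x =>
    right
    induction x with
    | top =>
      exfalso
      have h' : ((⊤ : ℕ∞) : WithBot ℕ∞) ≤ ((Nat.card (Fin (n + 1)) : ℕ∞) : WithBot ℕ∞) := h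
      rw [WithBot.coe_le_coe] at h'
      exact absurd h' (by simp)
    | coe k => exact ⟨k, rfl⟩

theorem exists_ringKrullDim_eq {W : Set (ProjSpace n)} (hW : W.Nonempty) :
    ∃ k : ℕ, ringKrullDim (MvPolynomial (Fin (n + 1)) ℂ ⧸ homIdeal W) = (k : ℕ) ∧
      projDim W = k - 1 := by
  rcases ringKrullDim_quotient_eq_bot_or_natCast (homIdeal W) with h | ⟨k, hk⟩
  · exfalso
    have hne : homIdeal W ≠ ⊤ := by
      intro h1
      have h2 : (1 : MvPolynomial (Fin (n + 1)) ℂ) ∈ homIdeal W := by rw [h1]; trivial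
      simpa using eval_zero_of_mem_homIdeal hW h2
    have := Ideal.Quotient.nontrivial_iff.2 hne
    have h3 := ringKrullDim_nonneg_of_nontrivial
      (R := MvPolynomial (Fin (n + 1)) ℂ ⧸ homIdeal W)
    rw [h] at h3
    simp at h3
  · refine ⟨k, hk, ?_⟩
    rw [projDim, hk]
    rfl

theorem projDim_le_projDim_section_add (hd : 1 ≤ d) {V : Set (ProjSpace n)}
    (hV : IsProjectiveVariety V) (Q : Fin q → HomPoly n d) (Γ : Finset (Fin q)) {r : ℕ}
    (T : Fin r → HomPoly n d)
    (hT : ∀ j ∈ Γ, (Q j : MvPolynomial (Fin (n + 1)) ℂ) ∈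
      homIdeal V ⊔ Ideal.span (Set.range fun i => (T i : MvPolynomial (Fin (n + 1)) ℂ)))
    (hW : (V ∩ ⋂ j ∈ Γ, hypersurface (Q j : MvPolynomial (Fin (n + 1)) ℂ)).Nonempty) :
    projDim V ≤ projDim (V ∩ ⋂ j ∈ Γ, hypersurface (Q j : MvPolynomial (Fin (n + 1)) ℂ)) + r := by
  have h := ringKrullDim_section_le hd hV Q Γ T hT
  have h0 : vanishingIdeal ℂ (insert 0 (puncturedCone
      (V ∩ ⋂ j ∈ Γ, hypersurface (Q j : MvPolynomial (Fin (n + 1)) ℂ)))) =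
      homIdeal (V ∩ ⋂ j ∈ Γ, hypersurface (Q j : MvPolynomial (Fin (n + 1)) ℂ)) := by
    refine le_antisymm (vanishingIdeal_anti_mono (Set.subset_insert _ _)) fun P hP => ?_
    rw [mem_vanishingIdeal_iff]
    rintro x (rfl | hx)
    · rw [aeval_eq_eval]
      exact eval_zero_of_mem_homIdeal hW hP
    · rw [aeval_eq_eval]
      exact mem_homIdeal.1 hP x hx
  rw [h0] at h
  obtain ⟨k, hk, hk'⟩ := exists_ringKrullDim_eq hV.nonempty
  obtain ⟨l, hl, hl'⟩ := exists_ringKrullDim_eq hW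
  rw [hk, hl] at h
  have h' : k ≤ l + r := by exact_mod_cast h
  -- The truncated subtractions in `projDim` do no harm: `k - 1 ≤ (l - 1) + r` holds also for `l =
  -- 0`.
  omega

/-- Were the section empty, its cone would be the vertex alone, of dimension `0`, and the cone over
`V` would have dimension at most `1`. -/
theorem section_nonempty (hd : 1 ≤ d) {V : Set (ProjSpace n)} (hV : IsProjectiveVariety V)
    (hk : 1 ≤ projDim V) (Q : Fin q → HomPoly n d) (j : Fin q) :
    (V ∩ ⋂ i ∈ ({j} : Finset (Fin q)),
      hypersurface (Q i : MvPolynomial (Fin (n + 1)) ℂ)).Nonempty := by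
  by_contra hW
  have h := ringKrullDim_section_le hd hV Q {j} (r := 1) (fun _ => Q j) (fun i hi => by
    rw [Finset.mem_singleton.1 hi]
    exact Ideal.mem_sup_right (Ideal.subset_span ⟨0, rfl⟩))
  rw [← puncturedCone_nonempty_iff, Set.not_nonempty_iff_eq_empty] at hW
  rw [hW] at h
  have hmax : (vanishingIdeal ℂ {(0 : Fin (n + 1) → ℂ)}).IsMaximal :=
    isMaximal_iff_eq_vanishingIdeal_singleton.2 ⟨0, rfl⟩
  rw [insert_empty_eq, ringKrullDim_eq_zero_of_isField
    ((Ideal.Quotient.maximal_ideal_iff_isField_quotient _).1 hmax)] at h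
  obtain ⟨k, hk1, hk2⟩ := exists_ringKrullDim_eq hV.nonempty
  rw [hk1] at h
  have h' : k ≤ 0 + 1 := by exact_mod_cast h
  omega

/-- Some `Q j` with `j ∈ Γ` is a non-zero-divisor in the coordinate ring of `V`, a domain, and
vanishes on the section. -/
theorem projDim_section_lt {V : Set (ProjSpace n)} (hV : IsProjectiveVariety V)
    (hk : 1 ≤ projDim V) (Q : Fin q → HomPoly n d)
    (hQ : ∀ j, (Q j : MvPolynomial (Fin (n + 1)) ℂ) ∉ homIdeal V) {Γ : Finset (Fin q)}
    (hΓ : Γ.Nonempty)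
    (hW : (V ∩ ⋂ j ∈ Γ, hypersurface (Q j : MvPolynomial (Fin (n + 1)) ℂ)).Nonempty) :
    projDim (V ∩ ⋂ j ∈ Γ, hypersurface (Q j : MvPolynomial (Fin (n + 1)) ℂ)) < projDim V := by
  obtain ⟨j, hj⟩ := hΓ
  have := hV.irreducible
  obtain ⟨k, hk1, hk2⟩ := exists_ringKrullDim_eq hV.nonempty
  obtain ⟨l, hl, hl'⟩ := exists_ringKrullDim_eq hW
  have hle := homIdeal_anti (Set.inter_subset_left (s := V)
    (t := ⋂ j ∈ Γ, hypersurface (Q j : MvPolynomial (Fin (n + 1)) ℂ)))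
  have h := ringKrullDim_succ_le_of_surjective (Ideal.Quotient.factor hle)
    (Ideal.Quotient.factor_surjective hle)
    (r := Ideal.Quotient.mk _ (Q j : MvPolynomial (Fin (n + 1)) ℂ))
    (mem_nonZeroDivisors_of_ne_zero fun h0 => hQ j (Ideal.Quotient.eq_zero_iff_mem.1 h0)) (by
      rw [Ideal.Quotient.factor_mk, Ideal.Quotient.eq_zero_iff_mem, mem_homIdeal]
      intro x hx
      exact (mem_puncturedCone_section.1 hx).2 j hj)
  rw [hk1, hl] at h
  have h' : l + 1 ≤ k := by exact_mod_cast h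
  omega

end Projective

end HolCurve

namespace HolCurve

/-! ### The distributive constant and ranks in `I_d(V)`. -/

section Distributive

open MvPolynomial

variable {n d M q : ℕ} {V : Set (ProjSpace n)} {v : Fin (M + 1) → HomPoly n d}
  {b : Module.Basis (Fin (M + 1)) ℂ (CoordPart V d)}

theorem sub_sum_repr_mem_homIdeal (hb : ∀ i, b i = (homIdealPart V d).mkQ (v i))
    (P : HomPoly n d) :
    ((P - ∑ i, b.repr ((homIdealPart V d).mkQ P) i • v i : HomPoly n d) :
      MvPolynomial (Fin (n + 1)) ℂ) ∈ homIdeal V := by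
  have h : P - ∑ i, b.repr ((homIdealPart V d).mkQ P) i • v i ∈ homIdealPart V d := by
    refine (Submodule.Quotient.mk_eq_zero _).1 ?_
    rw [← Submodule.mkQ_apply, map_sub, map_sum]
    simp only [map_smul, ← hb]
    rw [b.sum_repr, sub_self]
  exact h

theorem eval_eq_sum_repr (hb : ∀ i, b i = (homIdealPart V d).mkQ (v i)) (P : HomPoly n d)
    {x : Fin (n + 1) → ℂ} (hx : x ∈ puncturedCone V) :
    eval x (P : MvPolynomial (Fin (n + 1)) ℂ) = ∑ i, b.repr ((homIdealPart V d).mkQ P) i *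
      eval x (v i : MvPolynomial (Fin (n + 1)) ℂ) := by
  have h := mem_homIdeal.1 (sub_sum_repr_mem_homIdeal hb P) x hx
  rw [Submodule.coe_sub, map_sub, sub_eq_zero] at h
  rw [h, Submodule.coe_sum, map_sum]
  refine Finset.sum_congr rfl fun i _ => ?_
  rw [Submodule.coe_smul, smul_eval]

/-- Expand `x_k ^ d` in the basis, for a nonzero coordinate `x_k`. -/
theorem exists_eval_basis_ne_zero (hb : ∀ i, b i = (homIdealPart V d).mkQ (v i))
    {x : Fin (n + 1) → ℂ} (hx : x ∈ puncturedCone V) :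
    ∃ i, eval x (v i : MvPolynomial (Fin (n + 1)) ℂ) ≠ 0 := by
  by_contra! h
  obtain ⟨k, hk⟩ := Function.ne_iff.1 hx.1
  have h1 := eval_eq_sum_repr hb (⟨X k ^ d, by simpa using (isHomogeneous_X ℂ k).pow d⟩ : HomPoly n d) hx
  simp [h] at h1
  exact hk h1.1

/-- For `M = 0` each `Q j` is a multiple of `v 0` modulo `I(V)`. It has a zero on `V`, where `v 0`
does not vanish, so the multiple is zero. -/
theorem index_pos (hd : 1 ≤ d) (hV : IsProjectiveVariety V) (hk : 1 ≤ projDim V)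
    (hb : ∀ i, b i = (homIdealPart V d).mkQ (v i)) {Q : Fin q → HomPoly n d}
    (hQ : ∀ j, (Q j : MvPolynomial (Fin (n + 1)) ℂ) ∉ homIdeal V) (j : Fin q) : 1 ≤ M := by
  by_contra hM
  obtain rfl : M = 0 := by omega
  obtain ⟨x, hx⟩ := puncturedCone_nonempty_iff.2 (section_nonempty hd hV hk Q j)
  rw [mem_puncturedCone_section] at hx
  have h1 := hx.2 j (Finset.mem_singleton_self j)
  rw [eval_eq_sum_repr hb (Q j) hx.1] at h1
  obtain ⟨i, hi⟩ := exists_eval_basis_ne_zero hb hx.1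
  have hi0 : i = 0 := Fin.ext (by omega)
  rw [hi0] at hi
  simp only [Fin.sum_univ_succ, Fin.sum_univ_zero, add_zero, mul_eq_zero, hi, or_false] at h1
  refine hQ j (mem_homIdeal.2 fun y hy => ?_)
  rw [eval_eq_sum_repr hb (Q j) hy, Fin.sum_univ_succ, Fin.sum_univ_zero, h1, zero_mul, add_zero]

theorem le_distributiveConstant {Q : Fin q → HomPoly n d} {Γ : Finset (Fin q)} (hΓ : Γ.Nonempty)
    (hW : (V ∩ ⋂ j ∈ Γ, hypersurface (Q j : MvPolynomial (Fin (n + 1)) ℂ)).Nonempty) :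
    (Γ.card : ℝ) / ((projDim V : ℝ) -
      (projDim (V ∩ ⋂ j ∈ Γ, hypersurface (Q j : MvPolynomial (Fin (n + 1)) ℂ)) : ℝ)) ≤
      distributiveConstant V fun j => (Q j : MvPolynomial (Fin (n + 1)) ℂ) := by
  unfold distributiveConstant
  refine le_trans ?_ (le_ciSup (Set.finite_range _).bddAbove ⟨Γ, hΓ⟩)
  rw [if_neg hW.ne_empty]

theorem distributiveConstant_pos (hd : 1 ≤ d) (hV : IsProjectiveVariety V) (hk : 1 ≤ projDim V)
    {Q : Fin q → HomPoly n d} (hQ : ∀ j, (Q j : MvPolynomial (Fin (n + 1)) ℂ) ∉ homIdeal V)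
    (j : Fin q) :
    0 < distributiveConstant V fun j => (Q j : MvPolynomial (Fin (n + 1)) ℂ) := by
  have hW := section_nonempty hd hV hk Q j
  have hlt := projDim_section_lt hV hk Q hQ (Finset.singleton_nonempty j) hW
  refine lt_of_lt_of_le ?_ (le_distributiveConstant (Finset.singleton_nonempty j) hW)
  have : ((projDim (V ∩ ⋂ i ∈ ({j} : Finset (Fin q)),
    hypersurface (Q i : MvPolynomial (Fin (n + 1)) ℂ)) : ℕ) : ℝ) < projDim V := by exact_mod_cast hlt
  exact div_pos (by simp) (by linarith)

/-- The defining property of the distributive constant, in terms of ranks in `I_d(V)`. -/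
theorem card_le_distributiveConstant_mul (hd : 1 ≤ d) (hV : IsProjectiveVariety V)
    (hk : 1 ≤ projDim V) (hb : ∀ i, b i = (homIdealPart V d).mkQ (v i)) {Q : Fin q → HomPoly n d}
    (hQ : ∀ j, (Q j : MvPolynomial (Fin (n + 1)) ℂ) ∉ homIdeal V) {a : Fin q → Fin (M + 1) → ℂ}
    (ha : ∀ j i, a j i = b.repr ((homIdealPart V d).mkQ (Q j)) i) {Γ : Finset (Fin q)}
    (hΓ : Γ.Nonempty)
    (hW : (V ∩ ⋂ j ∈ Γ, hypersurface (Q j : MvPolynomial (Fin (n + 1)) ℂ)).Nonempty) :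
    (Γ.card : ℝ) ≤ (distributiveConstant V fun j => (Q j : MvPolynomial (Fin (n + 1)) ℂ)) *
      Module.finrank ℂ (Submodule.span ℂ (a '' Γ)) := by
  -- As many vectors as the rank span all `a j`, `j ∈ Γ`; the corresponding forms generate these `Q
  -- j` modulo `I(V)`, so the codimension of the section is at most the rank.
  obtain ⟨f, -, hf, -⟩ := Submodule.exists_fun_fin_finrank_span_eq ℂ (a '' (Γ : Set (Fin q)))
  have hT : ∀ j ∈ Γ, (Q j : MvPolynomial (Fin (n + 1)) ℂ) ∈ homIdeal V ⊔ Ideal.span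
      (Set.range fun i => ((∑ k, f i k • v k : HomPoly n d) : MvPolynomial (Fin (n + 1)) ℂ)) := by
    intro j hj
    have h1 : a j ∈ Submodule.span ℂ (Set.range f) := by
      rw [hf]
      exact Submodule.subset_span ⟨j, hj, rfl⟩
    obtain ⟨c, hc⟩ := (Submodule.mem_span_range_iff_exists_fun ℂ).1 h1
    have h2 := sub_sum_repr_mem_homIdeal hb (Q j)
    have h3 : ∑ i, b.repr ((homIdealPart V d).mkQ (Q j)) i • v i =
        ∑ i, c i • ∑ k, f i k • v k := by
      simp only [← ha, ← hc, Finset.smul_sum, Finset.sum_apply, Pi.smul_apply, smul_eq_mul,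
        Finset.sum_smul, mul_smul]
      rw [Finset.sum_comm]
    have h4 : (Q j : MvPolynomial (Fin (n + 1)) ℂ) =
        ((Q j - ∑ i, b.repr ((homIdealPart V d).mkQ (Q j)) i • v i : HomPoly n d) :
          MvPolynomial (Fin (n + 1)) ℂ) +
        ∑ i, c i • ((∑ k, f i k • v k : HomPoly n d) : MvPolynomial (Fin (n + 1)) ℂ) := by
      rw [Submodule.coe_sub, h3]
      push_cast
      ring
    rw [h4]
    refine Ideal.add_mem _ (Ideal.mem_sup_left h2) (Ideal.mem_sup_right (Ideal.sum_mem _ ?_))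
    intro i _
    rw [smul_eq_C_mul]
    exact Ideal.mul_mem_left _ _ (Ideal.subset_span ⟨i, rfl⟩)
  have h1 := projDim_le_projDim_section_add hd hV Q Γ _ hT hW
  have h2 := projDim_section_lt hV hk Q hQ hΓ hW
  have h3 := le_distributiveConstant (V := V) (Q := Q) hΓ hW
  have h4 := distributiveConstant_pos hd hV hk hQ hΓ.choose
  set w := projDim (V ∩ ⋂ j ∈ Γ, hypersurface (Q j : MvPolynomial (Fin (n + 1)) ℂ))
  have h1' : (projDim V : ℝ) ≤ w + Module.finrank ℂ (Submodule.span ℂ (a '' (Γ : Set (Fin q)))) := by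
    exact_mod_cast h1
  have h2' : (w : ℝ) < projDim V := by exact_mod_cast h2
  rw [div_le_iff₀ (by linarith)] at h3
  exact h3.trans (mul_le_mul_of_nonneg_left (by linarith) h4.le)

end Distributive

end HolCurve

namespace HolCurve

/-! ### Uniform bound for the number of small contact functions. -/

section Compactness

open MvPolynomial Matrix

variable {n d M q : ℕ} {V : Set (ProjSpace n)} {v : Fin (M + 1) → HomPoly n d}
  {b : Module.Basis (Fin (M + 1)) ℂ (CoordPart V d)}

/-- The matrix with rows `e i` has the right inverse `Eᴴ`, so its kernel, which contains `s`, has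
dimension `m - r`. -/
theorem IsOrthonormal.finrank_span_le {m r : ℕ} {e : Fin r → Fin m → ℂ} (he : IsOrthonormal e)
    {s : Set (Fin m → ℂ)} (hs : ∀ x ∈ s, ∀ i, e i ⬝ᵥ x = 0) :
    Module.finrank ℂ (Submodule.span ℂ s) + r ≤ m := by
  let E : Matrix (Fin r) (Fin m) ℂ := Matrix.of e
  have h1 : E * Eᴴ = 1 := by
    ext i j
    rw [Matrix.mul_apply, Matrix.one_apply, ← he i j]
    rfl
  have h2 : LinearMap.range E.mulVecLin = ⊤ := by
    rw [LinearMap.range_eq_top]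
    intro y
    refine ⟨Eᴴ *ᵥ y, ?_⟩
    rw [Matrix.mulVecLin_apply, Matrix.mulVec_mulVec, h1, Matrix.one_mulVec]
  have h3 := LinearMap.finrank_range_add_finrank_ker E.mulVecLin
  rw [h2, finrank_top] at h3
  simp only [Module.finrank_fin_fun] at h3
  have h4 : Submodule.span ℂ s ≤ LinearMap.ker E.mulVecLin := by
    rw [Submodule.span_le]
    intro x hx
    exact funext fun i => hs x hx i
  have h5 := Submodule.finrank_mono h4
  omega

theorem IsOrthonormal.norm_le_one {m : ℕ} {ι : Type*} [DecidableEq ι] {e : ι → Fin m → ℂ}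
    (he : IsOrthonormal e) (i : ι) (k : Fin m) : ‖e i k‖ ≤ 1 := by
  have h1 : ∑ l, ‖e i l‖ ^ 2 = 1 := by
    have h2 := he i i
    rw [if_pos rfl, dotProduct] at h2
    simp only [Pi.star_apply, RCLike.star_def, Complex.mul_conj'] at h2
    exact_mod_cast h2
  have h2 : ‖e i k‖ ^ 2 ≤ ∑ l, ‖e i l‖ ^ 2 :=
    Finset.single_le_sum (f := fun l => ‖e i l‖ ^ 2) (fun _ _ => sq_nonneg _) (Finset.mem_univ k)
  rw [h1] at h2
  exact (sq_le_one_iff₀ (norm_nonneg _)).1 h2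

/-- The pairs of a point `x` of the cone over `V` and an orthonormal family of vectors the first of
which is proportional to `v(x)`. -/
def framedPoints (V : Set (ProjSpace n)) (v : Fin (M + 1) → HomPoly n d) (p : ℕ) :
    Set ((Fin (n + 1) → ℂ) × (Fin (p + 1) → Fin (M + 1) → ℂ)) :=
  {y | y.1 ∈ puncturedCone V ∧ IsOrthonormal y.2 ∧
    ∀ i k, eval y.1 (v i : MvPolynomial (Fin (n + 1)) ℂ) * y.2 0 k =
      eval y.1 (v k : MvPolynomial (Fin (n + 1)) ℂ) * y.2 0 i}

/-- The condition `x ≠ 0` is not closed, but it follows from `‖x‖ = 1`; the other conditions are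
closed, and orthonormal vectors are bounded. -/
theorem isCompact_framedPoints (hV : IsProjectiveVariety V) (p : ℕ) :
    IsCompact (framedPoints V v p ∩ {y | ‖y.1‖ = 1}) := by
  obtain ⟨S, hS⟩ := hV.exists_equations
  have heq : framedPoints V v p ∩ {y | ‖y.1‖ = 1} = {y | ‖y.1‖ = 1} ∩
      ((⋂ P ∈ S, {y | eval y.1 P = 0}) ∩
      ((⋂ i, ⋂ j, {y | y.2 i ⬝ᵥ star (y.2 j) = if i = j then 1 else 0}) ∩
      (⋂ i, ⋂ k, {y | eval y.1 (v i : MvPolynomial (Fin (n + 1)) ℂ) * y.2 0 k =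
      eval y.1 (v k : MvPolynomial (Fin (n + 1)) ℂ) * y.2 0 i}))) := by
    ext y
    simp only [framedPoints, hS, IsOrthonormal, Set.mem_inter_iff, Set.mem_iInter,
      Set.mem_ofPred_eq]
    constructor
    · rintro ⟨⟨⟨-, h1⟩, h2, h3⟩, h4⟩
      exact ⟨h4, h1, h2, h3⟩
    · rintro ⟨h4, h1, h2, h3⟩
      refine ⟨⟨⟨?_, h1⟩, h2, h3⟩, h4⟩
      rintro h0
      simp [h0] at h4
  have hev : ∀ P : MvPolynomial (Fin (n + 1)) ℂ, Continuous
      fun y : (Fin (n + 1) → ℂ) × (Fin (p + 1) → Fin (M + 1) → ℂ) => eval y.1 P := fun P =>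
    (MvPolynomial.continuous_eval P).comp continuous_fst
  refine Metric.isCompact_of_isClosed_isBounded ?_ ?_
  · rw [heq]
    refine IsClosed.inter (isClosed_eq (by fun_prop) continuous_const) (IsClosed.inter ?_
      (IsClosed.inter ?_ ?_))
    · exact isClosed_biInter fun P _ => isClosed_eq (hev P) continuous_const
    · refine isClosed_iInter fun i => isClosed_iInter fun j => isClosed_eq ?_ continuous_const
      simp only [dotProduct, Pi.star_apply]
      fun_prop
    · exact isClosed_iInter fun i => isClosed_iInter fun k =>
        isClosed_eq ((hev _).mul (by fun_prop)) ((hev _).mul (by fun_prop))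
  · refine (Metric.isBounded_closedBall (x := 0) (r := 1)).subset ?_
    rintro y ⟨⟨-, he, -⟩, hy⟩
    rw [mem_closedBall_zero_iff, Prod.norm_def, max_le_iff]
    exact ⟨le_of_eq hy, (pi_norm_le_iff_of_nonneg zero_le_one).2 fun i =>
      (pi_norm_le_iff_of_nonneg zero_le_one).2 fun k => he.norm_le_one i k⟩

theorem smul_mem_framedPoints {p : ℕ} {x : Fin (n + 1) → ℂ} {e : Fin (p + 1) → Fin (M + 1) → ℂ}
    (h : (x, e) ∈ framedPoints V v p) {c : ℂ} (hc : c ≠ 0) : (c • x, e) ∈ framedPoints V v p := by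
  obtain ⟨h1, h2, h3⟩ := h
  refine ⟨smul_mem_puncturedCone h1 hc, h2, fun i k => ?_⟩
  have h4 := h3 i k
  simp only at h4 ⊢
  rw [eval_smul_of_isHomogeneous (v i).2, eval_smul_of_isHomogeneous (v k).2, mul_assoc, h4,
    mul_assoc]

/-- Uniformly in the point and the frame, few of the contact functions are small. -/
theorem exists_card_contact_small_le (hd : 1 ≤ d) (hV : IsProjectiveVariety V)
    (hk : 1 ≤ projDim V) (hb : ∀ i, b i = (homIdealPart V d).mkQ (v i)) {Q : Fin q → HomPoly n d}
    (hQ : ∀ j, (Q j : MvPolynomial (Fin (n + 1)) ℂ) ∉ homIdeal V) {a : Fin q → Fin (M + 1) → ℂ}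
    (ha : ∀ j i, a j i = b.repr ((homIdealPart V d).mkQ (Q j)) i)
    {Δ : ℝ} (hΔ : Δ = distributiveConstant V fun j => (Q j : MvPolynomial (Fin (n + 1)) ℂ))
    (hΔ0 : 0 < Δ) {p : ℕ} (hp : p ≤ M) :
    ∃ c : ℝ, 0 < c ∧ ∀ y ∈ framedPoints V v p,
      ((Finset.univ.filter fun j => ∑ i, ‖y.2 i ⬝ᵥ a j‖ ^ 2 < c).card : ℝ) ≤ Δ * (M - p) := by
  -- For a `Γ` that is too large the projections cannot vanish simultaneously, so their sum over `Γ`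
  -- has a positive lower bound on the compact set.
  have key : ∀ Γ : Finset (Fin q), Δ * (M - p) < Γ.card → ∃ c : ℝ, 0 < c ∧
      ∀ y ∈ framedPoints V v p, ∃ j ∈ Γ, c ≤ ∑ i, ‖y.2 i ⬝ᵥ a j‖ ^ 2 := by
    intro Γ hcard
    have hMp : (0 : ℝ) ≤ M - p := by
      have : (p : ℝ) ≤ M := by exact_mod_cast hp
      linarith
    have hΓ : Γ.Nonempty := by
      rw [← Finset.card_pos]
      have : (0 : ℝ) < Γ.card := lt_of_le_of_lt (mul_nonneg hΔ0.le hMp) hcard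
      exact_mod_cast this
    have hcont : Continuous fun y : (Fin (n + 1) → ℂ) × (Fin (p + 1) → Fin (M + 1) → ℂ) =>
        ∑ j ∈ Γ, ∑ i, ‖y.2 i ⬝ᵥ a j‖ ^ 2 := by
      simp only [dotProduct]
      fun_prop
    obtain ⟨c, hc0, hc⟩ := (isCompact_framedPoints (v := v) hV p).exists_forall_le'
      hcont.continuousOn (a := 0) (by
      rintro y ⟨⟨hx, he, hpar⟩, -⟩
      refine lt_of_le_of_ne (Finset.sum_nonneg fun _ _ => Finset.sum_nonneg fun _ _ =>
        sq_nonneg _) fun h0 => ?_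
      have hz : ∀ j ∈ Γ, ∀ i, y.2 i ⬝ᵥ a j = 0 := by
        intro j hj i
        have h1 := (Finset.sum_eq_zero_iff_of_nonneg fun _ _ => Finset.sum_nonneg fun _ _ =>
          sq_nonneg _).1 h0.symm j hj
        have h2 := (Finset.sum_eq_zero_iff_of_nonneg fun _ _ => sq_nonneg _).1 h1 i
          (Finset.mem_univ i)
        simpa using h2
      obtain ⟨k, hk0⟩ : ∃ k, y.2 0 k ≠ 0 := by
        by_contra! h
        have := he 0 0
        rw [if_pos rfl, dotProduct, Finset.sum_eq_zero fun k _ => by rw [h k, zero_mul]] at this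
        exact zero_ne_one this
      have hW : (V ∩ ⋂ j ∈ Γ, hypersurface (Q j : MvPolynomial (Fin (n + 1)) ℂ)).Nonempty := by
        refine puncturedCone_nonempty_iff.1 ⟨y.1, mem_puncturedCone_section.2 ⟨hx, fun j hj => ?_⟩⟩
        -- Since `v(x)` is parallel to the first frame vector, `Q_j(x)` times a nonzero coordinate
        -- of that vector is a multiple of its product with `a j`, which is zero.
        rw [eval_eq_sum_repr hb (Q j) hx, ← mul_eq_zero_iff_right hk0, Finset.sum_mul]
        have h1 := hz j hj 0
        calc ∑ i, b.repr ((homIdealPart V d).mkQ (Q j)) i *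
              eval y.1 (v i : MvPolynomial (Fin (n + 1)) ℂ) * y.2 0 k
            = ∑ i, eval y.1 (v k : MvPolynomial (Fin (n + 1)) ℂ) * (y.2 0 i * a j i) := by
              refine Finset.sum_congr rfl fun i _ => ?_
              rw [mul_assoc, hpar i k, ha]
              ring
          _ = 0 := by rw [← Finset.mul_sum, ← dotProduct, h1, mul_zero]
      have h1 := card_le_distributiveConstant_mul hd hV hk hb hQ ha hΓ hW
      rw [← hΔ] at h1
      have h2 := he.finrank_span_le (s := a '' Γ) (by
        rintro _ ⟨j, hj, rfl⟩ i
        exact hz j hj i)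
      have h3 : (Module.finrank ℂ (Submodule.span ℂ (a '' (Γ : Set (Fin q)))) : ℝ) ≤ M - p := by
        have : Module.finrank ℂ (Submodule.span ℂ (a '' (Γ : Set (Fin q)))) + p ≤ M := by omega
        have : (Module.finrank ℂ (Submodule.span ℂ (a '' (Γ : Set (Fin q)))) : ℝ) + p ≤ M := by
          exact_mod_cast this
        linarith
      have h4 := mul_le_mul_of_nonneg_left h3 hΔ0.le
      linarith)
    have hcard0 : (0 : ℝ) < Γ.card := by exact_mod_cast hΓ.card_pos
    refine ⟨c / Γ.card, div_pos hc0 hcard0, ?_⟩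
    rintro ⟨x, e⟩ hy
    have hx0 : ‖x‖ ≠ 0 := norm_ne_zero_iff.2 hy.1.1
    -- The sums depend on the frame only, so the point may be scaled to norm one.
    have hmem : (((‖x‖⁻¹ : ℝ) : ℂ) • x, e) ∈ framedPoints V v p ∩ {y | ‖y.1‖ = 1} := by
      refine ⟨smul_mem_framedPoints hy (by exact_mod_cast inv_ne_zero hx0), ?_⟩
      change ‖((‖x‖⁻¹ : ℝ) : ℂ) • x‖ = 1
      rw [norm_smul, Complex.norm_real, norm_inv, norm_norm, inv_mul_cancel₀ hx0]
    by_contra! hlt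
    have h1 := hc _ hmem
    have h2 : ∑ j ∈ Γ, ∑ i, ‖e i ⬝ᵥ a j‖ ^ 2 < ∑ j ∈ Γ, c / Γ.card :=
      Finset.sum_lt_sum_of_nonempty hΓ hlt
    rw [Finset.sum_const, nsmul_eq_mul, mul_div_cancel₀ _ hcard0.ne'] at h2
    exact absurd h1 (not_le.2 h2)
  choose! c hc0 hc using key
  -- The least constant over the finitely many excessive `Γ`; the inserted `1` covers the case that
  -- there are none.
  have hne : (insert (1 : ℝ) ((Finset.univ.filter fun Γ : Finset (Fin q) =>
    Δ * (M - p) < Γ.card).image c)).Nonempty := Finset.insert_nonempty _ _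
  refine ⟨Finset.min' _ hne, ?_, fun y hy => ?_⟩
  · rw [Finset.lt_min'_iff]
    intro t ht
    rcases Finset.mem_insert.1 ht with rfl | ht
    · exact one_pos
    · obtain ⟨Γ, hΓ, rfl⟩ := Finset.mem_image.1 ht
      exact hc0 Γ (Finset.mem_filter.1 hΓ).2
  · by_contra! hlt
    obtain ⟨j, hj, hcj⟩ := hc _ hlt y hy
    have h1 := (Finset.mem_filter.1 hj).2
    refine absurd (hcj.trans_lt h1) (not_lt.2 (Finset.min'_le _ _ ?_))
    exact Finset.mem_insert_of_mem (Finset.mem_image_of_mem _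
      (Finset.mem_filter.2 ⟨Finset.mem_univ _, hlt⟩))

end Compactness

end HolCurve

namespace HolCurve

/-! ### From sums over the divisors to products -/

section RealInequalities

/-- Let `X` be the sum, which bounds every `Φ j`. If `X ≤ 1`, the product is at most `X ^ (qθ) ≤ X`,
`q` being the number of factors, because `qθ ≥ 1`. If `X ≥ 1`, factors outside `S` are bounded by
powers of `K`, and those in `S` contribute at most `X ^ (#S θ) ≤ X`. -/
theorem prod_rpow_le_mul_sum {ι : Type*} [Fintype ι] {Φ : ι → ℝ} (hΦ : ∀ j, 0 ≤ Φ j) {θ K : ℝ}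
    (hθ : 0 < θ) (hK : 1 ≤ K) (S : Finset ι) (hS : (S.card : ℝ) * θ ≤ 1)
    (hSc : ∀ j ∉ S, Φ j ≤ K) (hq : 1 ≤ (Fintype.card ι : ℝ) * θ) :
    ∏ j, Φ j ^ θ ≤ K ^ ((Fintype.card ι : ℝ) * θ) * ∑ j, Φ j := by
  classical
  set X := ∑ j, Φ j with hX
  have hX0 : 0 ≤ X := Finset.sum_nonneg fun j _ => hΦ j
  have hle : ∀ j, Φ j ≤ X := fun j => Finset.single_le_sum (fun j _ => hΦ j) (Finset.mem_univ j)
  have hK1 : 1 ≤ K ^ ((Fintype.card ι : ℝ) * θ) := Real.one_le_rpow hK (by linarith)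
  rcases le_total X 1 with h1 | h1
  · calc ∏ j, Φ j ^ θ ≤ ∏ _j : ι, X ^ θ :=
          Finset.prod_le_prod (fun j _ => Real.rpow_nonneg (hΦ j) _) fun j _ =>
            Real.rpow_le_rpow (hΦ j) (hle j) hθ.le
      _ = X ^ ((Fintype.card ι : ℝ) * θ) := by
          rw [Finset.prod_const, Finset.card_univ, mul_comm, Real.rpow_mul hX0, Real.rpow_natCast]
      _ ≤ X ^ (1 : ℝ) := Real.rpow_le_rpow_of_exponent_ge' hX0 h1 zero_le_one hq
      _ = 1 * X := by rw [Real.rpow_one, one_mul]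
      _ ≤ _ := by gcongr
  · calc ∏ j, Φ j ^ θ ≤ ∏ j, (K ^ θ * if j ∈ S then X ^ θ else 1) := by
          refine Finset.prod_le_prod (fun j _ => Real.rpow_nonneg (hΦ j) _) fun j _ => ?_
          split_ifs with hj
          · calc Φ j ^ θ ≤ 1 * X ^ θ := by
                  rw [one_mul]
                  exact Real.rpow_le_rpow (hΦ j) (hle j) hθ.le
              _ ≤ K ^ θ * X ^ θ := by
                  gcongr
                  exact Real.one_le_rpow hK hθ.le
          · rw [mul_one]
            exact Real.rpow_le_rpow (hΦ j) (hSc j hj) hθ.le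
      _ = K ^ ((Fintype.card ι : ℝ) * θ) * X ^ ((S.card : ℝ) * θ) := by
          rw [Finset.prod_mul_distrib, Finset.prod_const, Finset.card_univ,
            Finset.prod_ite_mem, Finset.univ_inter, Finset.prod_const, mul_comm _ θ, mul_comm _ θ,
            Real.rpow_mul (by linarith), Real.rpow_mul hX0, Real.rpow_natCast, Real.rpow_natCast]
      _ ≤ K ^ ((Fintype.card ι : ℝ) * θ) * X ^ (1 : ℝ) := by
          gcongr
      _ = _ := by rw [Real.rpow_one]

theorem prod_range_curvature {M : ℕ} {H : ℕ → ℝ} (hH : ∀ r ≤ M + 1, H r ≠ 0) (h0 : H 0 = 1) :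
    ∏ p ∈ Finset.range M, H p * H (p + 2) / H (p + 1) ^ 2 = H (M + 1) / (H M * H 1) := by
  induction M with
  | zero =>
    have := hH 1 le_rfl
    simp [h0]
    field_simp
  | succ M ih =>
    have a1 := hH (M + 1) (by omega)
    have a2 := hH M (by omega)
    have a3 := hH 1 (by omega)
    rw [Finset.prod_range_succ, ih fun r hr => hH r (by omega)]
    field_simp

/-- Raising `M` by one multiplies the product by one more copy of every factor, that is, by
`prod_range_curvature`. -/
theorem prod_range_curvature_pow {M : ℕ} {H : ℕ → ℝ} (hH : ∀ r ≤ M + 1, H r ≠ 0) (h0 : H 0 = 1) :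
    ∏ p ∈ Finset.range M, (H p * H (p + 2) / H (p + 1) ^ 2) ^ (M - p) =
      H (M + 1) / H 1 ^ (M + 1) := by
  induction M with
  | zero =>
    have := hH 1 le_rfl
    simp
    field_simp
  | succ M ih =>
    have h1 : ∏ p ∈ Finset.range (M + 1), (H p * H (p + 2) / H (p + 1) ^ 2) ^ (M + 1 - p) =
        (∏ p ∈ Finset.range M, (H p * H (p + 2) / H (p + 1) ^ 2) ^ (M - p)) *
          ∏ p ∈ Finset.range (M + 1), H p * H (p + 2) / H (p + 1) ^ 2 := by
      rw [Finset.prod_range_succ, Finset.prod_range_succ _ M, ← mul_assoc,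
        ← Finset.prod_mul_distrib]
      congr 1
      · refine Finset.prod_congr rfl fun p hp => ?_
        rw [← pow_succ]
        congr 1
        have := Finset.mem_range.1 hp
        omega
      · rw [show M + 1 - M = 1 by omega, pow_one]
    have a1 := hH (M + 1) (by omega)
    have a3 := hH 1 (by omega)
    rw [h1, ih fun r hr => hH r (by omega), prod_range_curvature hH h0]
    field_simp
    ring

theorem sum_range_sub_eq (M : ℕ) :
    ∑ p ∈ Finset.range M, ((M : ℝ) - p) = M * (M + 1) / 2 := by
  have h : ∀ N : ℕ, ∑ p ∈ Finset.range N, ((M : ℝ) - p) = N * M - N * (N - 1) / 2 := by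
    intro N
    induction N with
    | zero => simp
    | succ N ih =>
      rw [Finset.sum_range_succ, ih]
      push_cast
      ring
  rw [h]
  ring

/-- The weighted inequality between the arithmetic and geometric means, with the weights
`2(M - p) / (M(M + 1))`, for telescoping factors. -/
theorem telescoping_mean_inequality {M q : ℕ} (hM : 1 ≤ M) {Δ : ℝ} (hΔ : 0 < Δ) {H : ℕ → ℝ}
    (h0 : H 0 = 1) (hH : ∀ r ≤ M + 1, 0 < H r) {φ : Fin q → ℕ → ℝ} (hφ : ∀ j, ∀ p ≤ M, 0 < φ j p)
    {L : Fin q → ℕ → ℝ} (hL : ∀ j, ∀ p < M, 0 < L j p) :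
    ((∏ j, φ j M) ^ (1 / Δ)) ^ ((2 : ℝ) / (M * (M + 1))) *
      ((H 1 ^ ((q : ℝ) / Δ - M - 1) * H (M + 1)) /
        ∏ j, (H 1 * φ j 0 * ∏ p ∈ Finset.range M, L j p ^ 2) ^ (1 / Δ)) ^
          ((2 : ℝ) / (M * (M + 1))) ≤
      ∑ p ∈ Finset.range M, H p * H (p + 2) / H (p + 1) ^ 2 *
        ∏ j, (φ j (p + 1) / (φ j p * L j p ^ 2)) ^ (1 / (Δ * (M - p))) := by
  set κ : ℝ := (2 : ℝ) / (M * (M + 1)) with hκ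
  have hM0 : (1 : ℝ) ≤ M := by exact_mod_cast hM
  have hκ0 : 0 < κ := by positivity
  set Ω : ℕ → ℝ := fun p => H p * H (p + 2) / H (p + 1) ^ 2 with hΩ
  set Φ : Fin q → ℕ → ℝ := fun j p => φ j (p + 1) / (φ j p * L j p ^ 2) with hΦ
  have hΩ0 : ∀ p ∈ Finset.range M, 0 < Ω p := by
    intro p hp
    have := Finset.mem_range.1 hp
    have h1 := hH p (by omega)
    have h2 := hH (p + 1) (by omega)
    have h3 := hH (p + 2) (by omega)
    positivity
  have hΦ0 : ∀ j, ∀ p ∈ Finset.range M, 0 < Φ j p := by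
    intro j p hp
    have := Finset.mem_range.1 hp
    have h1 := hφ j p (by omega)
    have h2 := hφ j (p + 1) (by omega)
    have h3 := hL j p this
    positivity
  set X : ℕ → ℝ := fun p => Ω p * ∏ j, Φ j p ^ (1 / (Δ * (M - p))) with hX
  have hX0 : ∀ p ∈ Finset.range M, 0 < X p := fun p hp =>
    mul_pos (hΩ0 p hp) (Finset.prod_pos fun j _ => Real.rpow_pos_of_pos (hΦ0 j p hp) _)
  have hsub : ∀ p ∈ Finset.range M, (0 : ℝ) < M - p := by
    intro p hp
    have : (p : ℝ) < M := by exact_mod_cast Finset.mem_range.1 hp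
    linarith
  have hw1 : ∑ p ∈ Finset.range M, ((M : ℝ) - p) * κ = 1 := by
    rw [← Finset.sum_mul, sum_range_sub_eq, hκ]
    field_simp
  have hamgm := Real.geom_mean_le_arith_mean_weighted (Finset.range M) (fun p => ((M : ℝ) - p) * κ) X
    (fun p hp => (mul_pos (hsub p hp) hκ0).le) hw1 fun p hp => (hX0 p hp).le
  have hsum : ∑ p ∈ Finset.range M, ((M : ℝ) - p) * κ * X p ≤ ∑ p ∈ Finset.range M, X p := by
    refine Finset.sum_le_sum fun p hp => ?_
    have h1 : ((M : ℝ) - p) * κ ≤ 1 := by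
      rw [← hw1]
      exact Finset.single_le_sum (f := fun p : ℕ => ((M : ℝ) - p) * κ)
        (fun p hp => (mul_pos (hsub p hp) hκ0).le) hp
    nlinarith [(hX0 p hp).le]
  refine le_trans (le_of_eq ?_) (hamgm.trans hsum)
  -- The weight `(M - p)κ` turns the exponent `1 / (Δ(M - p))` into `κ / Δ`, the same for all `p`;
  -- this lets the contact functions telescope.
  have hXp : ∀ p ∈ Finset.range M, X p ^ (((M : ℝ) - p) * κ) =
      (Ω p ^ (M - p) * ∏ j, Φ j p ^ (1 / Δ)) ^ κ := by
    intro p hp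
    have h1 := hsub p hp
    have hnat : ((M - p : ℕ) : ℝ) = M - p := by
      rw [Nat.cast_sub (Finset.mem_range.1 hp).le]
    rw [Real.rpow_mul (hX0 p hp).le]
    congr 1
    rw [hX]
    simp only
    rw [Real.mul_rpow (hΩ0 p hp).le (Finset.prod_nonneg fun j _ =>
      Real.rpow_nonneg (hΦ0 j p hp).le _), ← hnat, Real.rpow_natCast, Real.rpow_natCast,
      ← Finset.prod_pow]
    congr 1
    refine Finset.prod_congr rfl fun j _ => ?_
    rw [← Real.rpow_natCast, ← Real.rpow_mul (hΦ0 j p hp).le, hnat]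
    congr 1
    field_simp
  rw [Finset.prod_congr rfl hXp, Real.finsetProd_rpow _ _ fun p hp =>
    mul_nonneg (pow_nonneg (hΩ0 p hp).le _) (Finset.prod_nonneg fun j _ =>
      Real.rpow_nonneg (hΦ0 j p hp).le _)]
  have hH1 := hH 1 (by omega)
  have hden : ∀ j, 0 < H 1 * φ j 0 * ∏ p ∈ Finset.range M, L j p ^ 2 := fun j =>
    mul_pos (mul_pos hH1 (hφ j 0 (by omega))) (Finset.prod_pos fun p hp =>
      pow_pos (hL j p (Finset.mem_range.1 hp)) 2)
  have hφM : 0 < ∏ j, φ j M := Finset.prod_pos fun j _ => hφ j M le_rfl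
  rw [← Real.mul_rpow (Real.rpow_nonneg hφM.le _) (div_nonneg (mul_nonneg
    (Real.rpow_nonneg hH1.le _) (hH _ le_rfl).le) (Finset.prod_nonneg fun j _ =>
      Real.rpow_nonneg (hden j).le _))]
  congr 1
  rw [Finset.prod_mul_distrib, prod_range_curvature_pow (fun r hr => (hH r hr).ne') h0,
    Finset.prod_comm]
  have hj : ∀ j, ∏ p ∈ Finset.range M, Φ j p ^ (1 / Δ) =
      (φ j M) ^ (1 / Δ) * H 1 ^ (1 / Δ) /
        (H 1 * φ j 0 * ∏ p ∈ Finset.range M, L j p ^ 2) ^ (1 / Δ) := by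
    intro j
    have hL2 : 0 < ∏ p ∈ Finset.range M, L j p ^ 2 :=
      Finset.prod_pos fun p hp => pow_pos (hL j p (Finset.mem_range.1 hp)) 2
    rw [Real.finsetProd_rpow _ _ fun p hp => (hΦ0 j p hp).le,
      ← Real.mul_rpow (hφ j M le_rfl).le hH1.le,
      ← Real.div_rpow (mul_pos (hφ j M le_rfl) hH1).le (hden j).le]
    congr 1
    have h1 : ∏ p ∈ Finset.range M, Φ j p =
        (∏ p ∈ Finset.range M, φ j (p + 1) / φ j p) / ∏ p ∈ Finset.range M, L j p ^ 2 := by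
      rw [← Finset.prod_div_distrib]
      refine Finset.prod_congr rfl fun p _ => ?_
      rw [hΦ]
      simp only
      rw [div_div]
    have h2 : ∏ p ∈ Finset.range M, φ j (p + 1) / φ j p = φ j M / φ j 0 := by
      have h3 : ∀ N ≤ M, ∏ p ∈ Finset.range N, φ j (p + 1) / φ j p = φ j N / φ j 0 := by
        intro N hN
        induction N with
        | zero => rw [Finset.prod_range_zero, div_self (hφ j 0 (by omega)).ne']
        | succ N ih =>
          rw [Finset.prod_range_succ, ih (by omega)]
          have := (hφ j N (by omega)).ne'
          field_simp
      exact h3 M le_rfl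
    rw [h1, h2]
    have := (hφ j 0 (by omega)).ne'
    field_simp
  rw [Finset.prod_congr rfl fun j _ => hj j, Finset.prod_div_distrib, Finset.prod_mul_distrib,
    Real.finsetProd_rpow _ _ fun j _ => (hφ j M le_rfl).le, Finset.prod_const, Finset.card_univ,
    Fintype.card_fin, ← Real.rpow_natCast (H 1 ^ (1 / Δ)), ← Real.rpow_mul hH1.le]
  -- The `q` factors `H 1 ^ (1 / Δ)` come from writing `φ j 0` as `H 1 * φ j 0` over `H 1`; the
  -- power `M + 1` comes from the curvatures.
  have h5 : H 1 ^ ((q : ℝ) / Δ - M - 1) = H 1 ^ (1 / Δ * (q : ℝ)) / H 1 ^ (M + 1) := by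
    rw [← Real.rpow_natCast, ← Real.rpow_sub hH1]
    congr 1
    push_cast
    ring
  rw [h5]
  ring

end RealInequalities

end HolCurve

namespace HolCurve

/-! ### The metric of the logarithmic singularities -/

section Total

open Filter Topology Matrix

variable {m q : ℕ}

theorem extNorm_wedgeSeq_zero_sq (u : ℕ → Fin m → ℂ) : extNorm (wedgeSeq u 0) ^ 2 = 1 := by
  have h : IsOrthonormal fun l : Fin 0 => u l := fun i => i.elim0
  rw [wedgeSeq, h.extNorm_ιMulti, one_pow]

theorem IsAdaptedFrame.contactRatio_eq {u : ℕ → Fin m → ℂ} {e : Fin m → Fin m → ℂ}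
    (he : IsAdaptedFrame u e) {p : ℕ} (hp : p + 1 ≤ m) (hX : wedgeSeq u (p + 1) ≠ 0)
    (H : Fin m → ℂ) :
    contactRatio u H p = ∑ i : Fin (p + 1), ‖e (Fin.castLE hp i) ⬝ᵥ star H‖ ^ 2 := by
  rw [contactRatio, he.extNorm_interiorProduct_wedgeSeq_sq hp,
    mul_div_cancel_left₀ _ (pow_pos (extNorm_pos hX) 2).ne']

/-- A projection does not increase the norm; where `F_p = 0` the quotient is `0` by convention. -/
theorem contactRatio_le {u : ℕ → Fin m → ℂ} {p : ℕ} (hp : p + 1 ≤ m) (H : Fin m → ℂ) :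
    contactRatio u H p ≤ ∑ i, ‖H i‖ ^ 2 := by
  by_cases hX : wedgeSeq u (p + 1) = 0
  · rw [contactRatio, hX, (extNorm_eq_zero _).2 rfl]
    simpa using Finset.sum_nonneg fun i _ => sq_nonneg ‖H i‖
  · obtain ⟨e, he⟩ := exists_isAdaptedFrame u
    rw [he.contactRatio_eq hp hX, ← he.sum_norm_sq H,
      ← Finset.sum_image (s := Finset.univ) (g := Fin.castLE hp)
        (f := fun i => ‖e i ⬝ᵥ star H‖ ^ 2) fun i _ j _ h => Fin.castLE_injective hp h]
    exact Finset.sum_le_sum_of_subset_of_nonneg (Finset.subset_univ _) fun _ _ _ => sq_nonneg _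

/-- For `p = M` the frame is a full orthonormal basis, and Parseval's identity applies. -/
theorem contactRatio_last {M : ℕ} {u : ℕ → Fin (M + 1) → ℂ} (hX : wedgeSeq u (M + 1) ≠ 0)
    (H : Fin (M + 1) → ℂ) : contactRatio u H M = ∑ i, ‖H i‖ ^ 2 := by
  obtain ⟨e, he⟩ := exists_isAdaptedFrame u
  rw [he.contactRatio_eq le_rfl hX, ← he.sum_norm_sq H]
  rfl

variable {U : ℂ → ℕ → Fin m → ℂ}

theorem eventually_wedgeSeq_ne_zero
    (hU : ∀ z l i, HasDerivAt (fun w => U w l i) (U z (l + 1) i) z) {p : ℕ} {z : ℂ}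
    (hX : wedgeSeq (U z) (p + 1) ≠ 0) : ∀ᶠ w in 𝓝 z, 0 < extNorm (wedgeSeq (U w) (p + 1)) := by
  filter_upwards [((hasExtDeriv_wedgeSeq hU p).wirtinger_extNorm_sq
    z).contDiffAt.continuousAt.eventually_ne (pow_pos (extNorm_pos hX) 2).ne'] with w hw
  exact lt_of_le_of_ne (extNorm_nonneg _) fun h => hw (by rw [← h]; norm_num)

theorem eventually_one_lt_div_contactRatio
    (hU : ∀ z l i, HasDerivAt (fun w => U w l i) (U z (l + 1) i) z) {p : ℕ} {z : ℂ}
    {H : Fin m → ℂ} (hφ : contactRatio (U z) H p ≠ 0) {δ : ℝ} (hδ : 1 < δ / contactRatio (U z) H p) :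
    ∀ᶠ w in 𝓝 z, 1 < δ / contactRatio (U w) H p := by
  have hX : extNorm (wedgeSeq (U z) (p + 1)) ^ 2 ≠ 0 := fun h0 => hφ (by rw [contactRatio, h0, div_zero])
  have h1 := ((hasExtDeriv_wedgeSeq hU p).wirtinger_extNorm_sq z).contDiffAt.continuousAt
  have h2 := (((hasExtDeriv_wedgeSeq hU p).interiorProduct H).wirtinger_extNorm_sq
    z).contDiffAt.continuousAt
  have h3 : ContinuousAt (fun w => δ / contactRatio (U w) H p) z :=
    continuousAt_const.div (h2.div h1 hX) hφ
  exact h3.eventually_const_lt hδ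

/-- For each `p` the errors of the `q` contact functions add up to at most `2 / Δ * (q * (2 / Λ))`
times the curvature, which `hε` lets `ε log |F_p|²` absorb. -/
theorem contDiffAt_and_le_ddc {M : ℕ} {U : ℂ → ℕ → Fin (M + 1) → ℂ}
    (hU : ∀ z l i, HasDerivAt (fun w => U w l i) (U z (l + 1) i) z) (H : Fin q → Fin (M + 1) → ℂ)
    {z : ℂ} (hX : ∀ p < M, wedgeSeq (U z) (p + 1) ≠ 0)
    (hφ : ∀ p < M, ∀ j, contactRatio (U z) (H j) p ≠ 0) {δ Δ Λ ε : ℝ} (hδ : 0 < δ) (hΔ : 0 < Δ)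
    (hΛ : 1 ≤ Λ) (hL : ∀ p < M, ∀ j, Λ ≤ Real.log (δ / contactRatio (U z) (H j) p))
    (hε : 2 / Δ * (q * (2 / Λ)) ≤ ε) :
    ContDiffAt ℝ 2 (fun w => Real.log
      ((∏ p ∈ Finset.range M, extNorm (wedgeSeq (U w) (p + 1)) ^ (2 * ε)) /
        ∏ j, ∏ p ∈ Finset.range M, Real.log (δ / contactRatio (U w) (H j) p) ^ (2 / Δ))) z ∧
    2 / Δ * ∑ p ∈ Finset.range M, curvature (U z) p * ∑ j,
      contactRatio (U z) (H j) (p + 1) / (contactRatio (U z) (H j) p *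
        Real.log (δ / contactRatio (U z) (H j) p) ^ 2) ≤
    ddc (fun w => Real.log
      ((∏ p ∈ Finset.range M, extNorm (wedgeSeq (U w) (p + 1)) ^ (2 * ε)) /
        ∏ j, ∏ p ∈ Finset.range M, Real.log (δ / contactRatio (U w) (H j) p) ^ (2 / Δ))) z := by
  -- The product splits into a sum of logarithms only near `z`, where all factors stay positive;
  -- this suffices for the derivatives at `z`.
  have hev : (fun w => Real.log
      ((∏ p ∈ Finset.range M, extNorm (wedgeSeq (U w) (p + 1)) ^ (2 * ε)) /
        ∏ j, ∏ p ∈ Finset.range M, Real.log (δ / contactRatio (U w) (H j) p) ^ (2 / Δ))) =ᶠ[𝓝 z]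
      fun w => ∑ p ∈ Finset.range M, ((ε * Real.log (extNorm (wedgeSeq (U w) (p + 1)) ^ 2)) -
        ∑ j, 2 / Δ * Real.log (Real.log (δ / contactRatio (U w) (H j) p))) := by
    have c1 : ∀ᶠ w in 𝓝 z, ∀ p ∈ Finset.range M, 0 < extNorm (wedgeSeq (U w) (p + 1)) :=
      (Finset.eventually_all _).2 fun p hp =>
        eventually_wedgeSeq_ne_zero hU (hX p (Finset.mem_range.1 hp))
    have c2 : ∀ᶠ w in 𝓝 z, ∀ p ∈ Finset.range M, ∀ j, 1 < δ / contactRatio (U w) (H j) p := by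
      refine (Finset.eventually_all _).2 fun p hp => eventually_all.2 fun j => ?_
      have hp := Finset.mem_range.1 hp
      have hpos : 0 < contactRatio (U z) (H j) p :=
        lt_of_le_of_ne (contactRatio_nonneg _ _ _) (hφ p hp j).symm
      exact eventually_one_lt_div_contactRatio hU (hφ p hp j)
        ((Real.log_pos_iff (div_pos hδ hpos).le).1 (by linarith [hL p hp j]))
    filter_upwards [c1, c2] with w hw1 hw2
    have hlp : ∀ j, ∀ p ∈ Finset.range M, 0 < Real.log (δ / contactRatio (U w) (H j) p) :=
      fun j p hp => Real.log_pos (hw2 p hp j)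
    rw [Real.log_div (Finset.prod_ne_zero_iff.2 fun p hp => (Real.rpow_pos_of_pos (hw1 p hp) _).ne')
      (Finset.prod_ne_zero_iff.2 fun j _ => Finset.prod_ne_zero_iff.2 fun p hp =>
        (Real.rpow_pos_of_pos (hlp j p hp) _).ne'),
      Real.log_prod fun p hp => (Real.rpow_pos_of_pos (hw1 p hp) _).ne',
      Real.log_prod fun j _ => Finset.prod_ne_zero_iff.2 fun p hp =>
        (Real.rpow_pos_of_pos (hlp j p hp) _).ne', Finset.sum_sub_distrib, Finset.sum_comm]
    congr 1
    · refine Finset.sum_congr rfl fun p hp => ?_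
      rw [Real.log_rpow (hw1 p hp), Real.log_pow]
      push_cast
      ring
    · refine Finset.sum_congr rfl fun j _ => ?_
      rw [Real.log_prod fun p hp => (Real.rpow_pos_of_pos (hlp j p hp) _).ne']
      exact Finset.sum_congr rfl fun p hp => Real.log_rpow (hlp j p hp) _
  have hA : ∀ p, ∃ D, p < M →
      HasWirtinger (fun w => Real.log (extNorm (wedgeSeq (U w) (p + 1)) ^ 2)) z D
        (curvature (U z) p) := by
    intro p
    by_cases hp : p < M
    · obtain ⟨D, hD⟩ := wirtinger_log_extNorm_wedgeSeq hU (by omega) (hX p hp)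
      exact ⟨D, fun _ => hD⟩
    · exact ⟨0, fun h => absurd h hp⟩
  have hB : ∀ p j, ∃ D K, p < M →
      HasWirtinger (fun w => Real.log (Real.log (δ / contactRatio (U w) (H j) p))) z D K ∧
        contactRatio (U z) (H j) (p + 1) / (contactRatio (U z) (H j) p *
            Real.log (δ / contactRatio (U z) (H j) p) ^ 2) * curvature (U z) p -
          (2 / Real.log (δ / contactRatio (U z) (H j) p)) * curvature (U z) p ≤ -K := by
    intro p j
    by_cases hp : p < M
    · obtain ⟨D, K, hDK⟩ := exists_wirtinger_log_log hU (by omega : p + 2 ≤ M + 1) (hφ p hp j) hδ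
        (hΛ.trans (hL p hp j))
      exact ⟨D, K, fun _ => hDK⟩
    · exact ⟨0, 0, fun h => absurd h hp⟩
  choose D hD using hA
  choose E K hEK using hB
  have hW := (HasWirtinger.sum (Finset.range M) fun p hp =>
    ((hD p (Finset.mem_range.1 hp)).const_mul ε).sub (HasWirtinger.sum Finset.univ fun j _ =>
      ((hEK p j (Finset.mem_range.1 hp)).1).const_mul (2 / Δ))).congr hev
  refine ⟨hW.contDiffAt, ?_⟩
  rw [hW.ddc_eq, Finset.mul_sum]
  refine Finset.sum_le_sum fun p hp => ?_
  have hp := Finset.mem_range.1 hp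
  have hΩ := curvature_nonneg (U z) p
  have h1 : ∀ j, 2 / Δ * (contactRatio (U z) (H j) (p + 1) / (contactRatio (U z) (H j) p *
        Real.log (δ / contactRatio (U z) (H j) p) ^ 2) * curvature (U z) p -
        2 / Λ * curvature (U z) p) ≤ -(2 / Δ * K p j) := by
    intro j
    rw [← mul_neg]
    refine mul_le_mul_of_nonneg_left (le_trans ?_ (hEK p j hp).2) (by positivity)
    have h2 : 2 / Real.log (δ / contactRatio (U z) (H j) p) ≤ 2 / Λ :=
      div_le_div_of_nonneg_left (by norm_num) (by linarith) (hL p hp j)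
    have := mul_le_mul_of_nonneg_right h2 hΩ
    linarith
  have h3 := Finset.sum_le_sum fun j (_ : j ∈ Finset.univ) => h1 j
  rw [← Finset.mul_sum, Finset.sum_sub_distrib, Finset.sum_const, Finset.card_univ,
    Fintype.card_fin, nsmul_eq_mul, ← Finset.sum_mul, Finset.sum_neg_distrib] at h3
  have h4 := mul_le_mul_of_nonneg_right hε hΩ
  have e1 : 2 / Δ * (q * (2 / Λ)) * curvature (U z) p =
    2 / Δ * (q * (2 / Λ * curvature (U z) p)) := by ring
  rw [e1] at h4
  rw [mul_sub] at h3
  rw [mul_comm (curvature (U z) p)]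
  linarith

end Total

/-! ### Derivatives of the curve `F`. -/

section Curve

variable {n d M : ℕ}

theorem hasDerivAt_curveDeriv (v : Fin (M + 1) → HomPoly n d) {ft : ℂ → Fin (n + 1) → ℂ}
    (hft : ∀ i, Differentiable ℂ fun z => ft z i) (z : ℂ) (l : ℕ) (i : Fin (M + 1)) :
    HasDerivAt (fun w => curveDeriv v ft l w i) (curveDeriv v ft (l + 1) z i) z := by
  have hd : Differentiable ℂ fun w =>
      MvPolynomial.eval (ft w) (v i : MvPolynomial (Fin (n + 1)) ℂ) := by
    simp only [MvPolynomial.eval_eq]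
    refine Differentiable.fun_sum fun s _ => Differentiable.const_mul ?_ _
    exact Differentiable.fun_finsetProd fun k _ => (hft k).pow _
  have h1 := (hd.contDiff (n := ((l + 1 : ℕ) : WithTop ℕ∞))).differentiable_iteratedDeriv l
    (by exact_mod_cast Nat.lt_succ_self l)
  have h2 := (h1 z).hasDerivAt
  rw [← iteratedDeriv_succ] at h2
  exact h2

end Curve

end HolCurve

namespace HolCurve

/-! ### Adapted frames of curves in `V`. -/

section Framed

open Matrix

variable {n d M : ℕ} {V : Set (ProjSpace n)} {v : Fin (M + 1) → HomPoly n d}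

/-- An adapted frame of a curve in `V` at a point is a framed point. -/
theorem IsAdaptedFrame.mem_framedPoints {ft : ℂ → Fin (n + 1) → ℂ} {z : ℂ}
    (hz : ft z ∈ puncturedCone V) {e : Fin (M + 1) → Fin (M + 1) → ℂ}
    (he : IsAdaptedFrame (fun l => curveDeriv v ft l z) e) {p : ℕ} (hp : p + 1 ≤ M + 1) :
    (ft z, fun i => e (Fin.castLE hp i)) ∈ framedPoints V v p := by
  refine ⟨hz, he.orthonormal.comp (Fin.castLE_injective hp), ?_⟩
  have h0 : ∀ i, MvPolynomial.eval (ft z) (v i : MvPolynomial (Fin (n + 1)) ℂ) =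
      (curveDeriv v ft 0 z ⬝ᵥ star (e 0)) * e 0 i := by
    intro i
    have h1 := congrFun (he.sum_eq (curveDeriv v ft 0 z)) i
    rw [Finset.sum_eq_single 0 (fun j _ hj => by
      have h : curveDeriv v ft 0 z ⬝ᵥ star (e j) = 0 :=
        he.triangular 0 j (Fin.pos_iff_ne_zero.2 hj)
      rw [h, zero_smul]) (by simp)] at h1
    simpa [curveDeriv] using h1
  intro i k
  have hc : Fin.castLE hp (0 : Fin (p + 1)) = 0 := rfl
  simp only [hc, h0]
  ring

end Framed

end HolCurve

/-! ### The choice of constants and the conclusion. -/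

theorem theorem3p5 {n d M q : ℕ} (hd : 1 ≤ d)
    (V : Set (ProjSpace n)) (hV : IsProjectiveVariety V) (hk : 1 ≤ projDim V)
    (v : Fin (M + 1) → HomPoly n d) (b : Module.Basis (Fin (M + 1)) ℂ (CoordPart V d))
    (hb : ∀ i, b i = (homIdealPart V d).mkQ (v i))
    (Q : Fin q → HomPoly n d)
    (hQ : ∀ j, (Q j : MvPolynomial (Fin (n + 1)) ℂ) ∉ homIdeal V)
    (a : Fin q → Fin (M + 1) → ℂ)
    (ha : ∀ j i, a j i = b.repr ((homIdealPart V d).mkQ (Q j)) i)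
    (Δ : ℝ) (hΔ : Δ = distributiveConstant V fun j => (Q j : MvPolynomial (Fin (n + 1)) ℂ))
    (hq : Δ * ((M : ℝ) + 1) < (q : ℝ))
    (ε : ℝ) (hε : 0 < ε) :
    ∃ δ : ℝ, 1 < δ ∧ ∃ C : ℝ, 0 < C ∧
      ∀ (f : ℂ → ProjSpace n) (ft : ℂ → Fin (n + 1) → ℂ),
        IsReducedRepresentation f ft → (∀ z, f z ∈ V) → ¬ IsDegenerateOver V d f →
        ∀ z : ℂ,
          (∀ p < M, derivedCurve v ft p z ≠ 0) →
          (∀ p < M, ∀ j, contactFunction v ft (a j) p z ≠ 0) →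
          (∀ p < M, ∀ j, contactFunction v ft (a j) p z < δ) ∧
          ContDiffAt ℝ 2 (fun w =>
            Real.log ((∏ p ∈ Finset.range M, extNorm (derivedCurve v ft p w) ^ (2 * ε)) /
              ∏ j, ∏ p ∈ Finset.range M,
                Real.log (δ / contactFunction v ft (a j) p w) ^ (2 / Δ))) z ∧
          C * ((extNorm (derivedCurve v ft 0 z) ^ (2 * ((q : ℝ) / Δ - M - 1)) *
                  extNorm (derivedCurve v ft M z) ^ 2) /
                ∏ j, (extNorm (contactVector v ft (a j) 0 z) ^ 2 *
                  ∏ p ∈ Finset.range M,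
                    Real.log (δ / contactFunction v ft (a j) p z) ^ 2) ^ (1 / Δ)) ^
                ((2 : ℝ) / ((M : ℝ) * ((M : ℝ) + 1))) *
              ddc (fun w => ‖w‖ ^ 2) z ≤
            ddc (fun w =>
              Real.log ((∏ p ∈ Finset.range M, extNorm (derivedCurve v ft p w) ^ (2 * ε)) /
                ∏ j, ∏ p ∈ Finset.range M,
                  Real.log (δ / contactFunction v ft (a j) p w) ^ (2 / Δ))) z := by
  obtain ⟨j₀⟩ : Nonempty (Fin q) := by
    by_contra hne
    rw [not_nonempty_iff] at hne
    have hq0 : q = 0 := by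
      by_contra h
      exact hne.elim ⟨0, Nat.pos_of_ne_zero h⟩
    subst hq0
    -- For `q = 0` the supremum runs over the empty type and is `0`, which contradicts `hq`.
    have hE : IsEmpty {Γ : Finset (Fin 0) // Γ.Nonempty} :=
      ⟨fun Γ => Γ.2.choose.elim0⟩
    have : Δ = 0 := by
      rw [hΔ, distributiveConstant, Real.iSup_of_isEmpty]
    rw [this] at hq
    simp at hq
  have hM : 1 ≤ M := index_pos hd hV hk hb hQ j₀
  have hM' : (1 : ℝ) ≤ M := by exact_mod_cast hM
  have hΔ0 : 0 < Δ := hΔ ▸ distributiveConstant_pos hd hV hk hQ j₀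
  have hq0 : (0 : ℝ) < q := lt_trans (by positivity) hq
  set β : Fin q → ℝ := fun j => ∑ i, ‖a j i‖ ^ 2 with hβ
  have hβ0 : ∀ j, 0 < β j := by
    intro j
    refine lt_of_le_of_ne (Finset.sum_nonneg fun _ _ => sq_nonneg _) fun h0 => hQ j ?_
    have ha0 : ∀ i, a j i = 0 := fun i => by
      simpa using (Finset.sum_eq_zero_iff_of_nonneg fun _ _ => sq_nonneg _).1 h0.symm i
        (Finset.mem_univ i)
    have h1 := sub_sum_repr_mem_homIdeal hb (Q j)
    have h2 : ∑ i, b.repr ((homIdealPart V d).mkQ (Q j)) i • v i = 0 :=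
      Finset.sum_eq_zero fun i _ => by rw [← ha, ha0, zero_smul]
    rwa [h2, sub_zero] at h1
  -- A common bound for all contact functions, since `φ_p(Q_j) ≤ |a_j|² = β j`.
  set B : ℝ := 1 + ∑ j, β j with hB
  have hB1 : 1 ≤ B := by
    have : 0 ≤ ∑ j, β j := Finset.sum_nonneg fun j _ => (hβ0 j).le
    linarith
  have hβB : ∀ j, β j ≤ B := fun j => by
    have := Finset.single_le_sum (f := β) (fun j _ => (hβ0 j).le) (Finset.mem_univ j)
    linarith
  have hsmall : ∀ p : ℕ, ∃ c : ℝ, 0 < c ∧ (p ≤ M → ∀ y ∈ framedPoints V v p,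
      ((Finset.univ.filter fun j => ∑ i, ‖dotProduct (y.2 i) (a j)‖ ^ 2 < c).card : ℝ) ≤
        Δ * (M - p)) := by
    intro p
    by_cases hp : p ≤ M
    · obtain ⟨c, hc0, hc⟩ := exists_card_contact_small_le hd hV hk hb hQ ha hΔ hΔ0 hp
      exact ⟨c, hc0, fun _ => hc⟩
    · exact ⟨1, one_pos, fun h => absurd h hp⟩
  choose c hc0 hc using hsmall
  -- Bounds every quotient `φ_{p+1} / (φ_p L²)` with `φ_p ≥ c p` and `L ≥ 1`.
  set K : ℝ := 1 + ∑ p ∈ Finset.range M, B / c p with hK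
  have hK1 : 1 ≤ K := by
    have : 0 ≤ ∑ p ∈ Finset.range M, B / c p :=
      Finset.sum_nonneg fun p _ => (div_pos (by linarith) (hc0 p)).le
    linarith
  have hcK : ∀ p < M, B / c p ≤ K := fun p hp => by
    have := Finset.single_le_sum (f := fun p => B / c p)
      (fun p _ => (div_pos (by linarith) (hc0 p)).le) (Finset.mem_range.2 hp)
    linarith
  -- The lower bound for all logarithms: large enough for the errors to be absorbed by `ε`. It is
  -- enforced by `δ = B * exp Λ`.
  set Λ : ℝ := 1 + 4 * q / (Δ * ε) with hΛ
  have hΛ1 : 1 ≤ Λ := by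
    have : 0 ≤ 4 * q / (Δ * ε) := by positivity
    linarith
  have hΛε : 2 / Δ * (q * (2 / Λ)) ≤ ε := by
    have h1 : 4 * q / (Δ * ε) ≤ Λ := by linarith
    have h2 : 2 / Δ * (q * (2 / Λ)) = 4 * q / (Δ * Λ) := by
      field_simp
      ring
    rw [h2, div_le_iff₀ (by positivity)]
    rw [div_le_iff₀ (by positivity)] at h1
    linarith
  set κ : ℝ := (2 : ℝ) / (M * (M + 1)) with hκ
  have hκ0 : 0 < κ := by positivity
  -- The factors come from the exponent `2 / Δ` of the logarithms, from the passage from sums to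
  -- products, and from the end value `φ_M(Q_j) = β j` of the telescoping product.
  set C : ℝ := 2 / Δ * (K ^ ((q : ℝ) * (1 / Δ)))⁻¹ * ((∏ j, β j) ^ (1 / Δ)) ^ κ with hC
  have hKpos : 0 < K ^ ((q : ℝ) * (1 / Δ)) := Real.rpow_pos_of_pos (by linarith) _
  have hC0 : 0 < C := by
    have h2 : 0 < ((∏ j, β j) ^ (1 / Δ)) ^ κ :=
      Real.rpow_pos_of_pos (Real.rpow_pos_of_pos (Finset.prod_pos fun j _ => hβ0 j) _) _
    positivity
  have hδ1 : 1 < B * Real.exp Λ := by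
    have : 1 < Real.exp Λ := Real.one_lt_exp_iff.2 (by linarith)
    nlinarith
  refine ⟨B * Real.exp Λ, hδ1, C, hC0, ?_⟩
  set δ := B * Real.exp Λ with hδ
  have hδ0 : 0 < δ := by linarith
  intro f ft hft hfV _ z hX hφ
  set U : ℂ → ℕ → Fin (M + 1) → ℂ := fun w l => curveDeriv v ft l w with hUdef
  have hU : ∀ z l i, HasDerivAt (fun w => U w l i) (U z (l + 1) i) z := fun z l i =>
    hasDerivAt_curveDeriv v hft.holomorphic z l i
  set H : Fin q → Fin (M + 1) → ℂ := fun j i => starRingEnd ℂ (a j i) with hH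
  have hHβ : ∀ j, ∑ i, ‖H j i‖ ^ 2 = β j := fun j => by
    simp only [hH, hβ, RCLike.norm_conj]
  have hstar : ∀ j, star (H j) = a j := fun j => by
    funext i
    simp [hH]
  change ∀ p < M, wedgeSeq (U z) (p + 1) ≠ 0 at hX
  change ∀ p < M, ∀ j, contactRatio (U z) (H j) p ≠ 0 at hφ
  have hφ0 : ∀ p < M, ∀ j, 0 < contactRatio (U z) (H j) p := fun p hp j =>
    lt_of_le_of_ne (contactRatio_nonneg _ _ _) (hφ p hp j).symm
  have hφB : ∀ p ≤ M, ∀ j, contactRatio (U z) (H j) p ≤ B := fun p hp j =>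
    (contactRatio_le (by omega) (H j)).trans ((hHβ j).le.trans (hβB j))
  have hL : ∀ p < M, ∀ j, Λ ≤ Real.log (δ / contactRatio (U z) (H j) p) := by
    intro p hp j
    rw [Real.le_log_iff_exp_le (div_pos hδ0 (hφ0 p hp j)), le_div_iff₀ (hφ0 p hp j), hδ, mul_comm]
    exact mul_le_mul_of_nonneg_right (hφB p hp.le j) (Real.exp_pos Λ).le
  obtain ⟨hsmooth, hmain⟩ := contDiffAt_and_le_ddc hU H hX hφ hδ0 hΔ0 hΛ1 hL hΛε
  refine ⟨fun p hp j => ?_, hsmooth, ?_⟩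
  · change contactRatio (U z) (H j) p < δ
    refine (hφB p hp.le j).trans_lt ?_
    have : 1 < Real.exp Λ := Real.one_lt_exp_iff.2 (by linarith)
    nlinarith
  refine le_trans ?_ hmain
  change C * ((extNorm (wedgeSeq (U z) 1) ^ (2 * ((q : ℝ) / Δ - M - 1)) *
      extNorm (wedgeSeq (U z) (M + 1)) ^ 2) /
    ∏ j, (extNorm (interiorProduct (wedgeSeq (U z) 1) (H j)) ^ 2 *
      ∏ p ∈ Finset.range M, Real.log (δ / contactRatio (U z) (H j) p) ^ 2) ^ (1 / Δ)) ^ κ *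
    ddc (fun w => ‖w‖ ^ 2) z ≤ _
  rw [ddc_norm_sq, mul_one]
  have hΦ0 : ∀ p < M, ∀ j, 0 ≤ contactRatio (U z) (H j) (p + 1) / (contactRatio (U z) (H j) p *
      Real.log (δ / contactRatio (U z) (H j) p) ^ 2) := fun p hp j =>
    div_nonneg (contactRatio_nonneg _ _ _) (mul_nonneg (contactRatio_nonneg _ _ _) (sq_nonneg _))
  by_cases hXM : wedgeSeq (U z) (M + 1) = 0
  · rw [hXM, (extNorm_eq_zero _).2 rfl]
    rw [zero_pow two_ne_zero, mul_zero, zero_div, Real.zero_rpow hκ0.ne', mul_zero]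
    exact mul_nonneg (by positivity) (Finset.sum_nonneg fun p hp =>
      mul_nonneg (curvature_nonneg _ _) (Finset.sum_nonneg fun j _ =>
        hΦ0 p (Finset.mem_range.1 hp) j))
  have hX' : ∀ p ≤ M, wedgeSeq (U z) (p + 1) ≠ 0 := fun p hp => by
    rcases hp.lt_or_eq with h | rfl
    · exact hX p h
    · exact hXM
  have hlast : ∀ j, contactRatio (U z) (H j) M = β j := fun j =>
    (contactRatio_last hXM (H j)).trans (hHβ j)
  have hmean := telescoping_mean_inequality hM hΔ0 (H := fun r => extNorm (wedgeSeq (U z) r) ^ 2)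
    (extNorm_wedgeSeq_zero_sq _) (fun r hr => by
      rcases r with _ | r
      · simp only [extNorm_wedgeSeq_zero_sq]
        exact one_pos
      · exact pow_pos (extNorm_pos (hX' r (by omega))) 2)
    (φ := fun j p => contactRatio (U z) (H j) p) (fun j p hp => by
      rcases hp.lt_or_eq with h | rfl
      · exact hφ0 p h j
      · simp only [hlast]
        exact hβ0 j)
    (L := fun j p => Real.log (δ / contactRatio (U z) (H j) p))
    (fun j p hp => by
      have := hL p hp j
      linarith)
  simp only [hlast] at hmean
  obtain ⟨e, he⟩ := exists_isAdaptedFrame (U z)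
  have hcone : ft z ∈ puncturedCone V := by
    obtain ⟨h, hz⟩ := hft.represents z
    exact ⟨h, hz ▸ hfV z⟩
  have hps : ∀ p < M, (K ^ ((q : ℝ) * (1 / Δ)))⁻¹ *
      ∏ j, (contactRatio (U z) (H j) (p + 1) / (contactRatio (U z) (H j) p *
        Real.log (δ / contactRatio (U z) (H j) p) ^ 2)) ^ (1 / (Δ * (M - p))) ≤
      ∑ j, contactRatio (U z) (H j) (p + 1) / (contactRatio (U z) (H j) p *
        Real.log (δ / contactRatio (U z) (H j) p) ^ 2) := by
    intro p hp
    have hMp : (1 : ℝ) ≤ M - p := by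
      have : (p : ℝ) + 1 ≤ M := by exact_mod_cast hp
      linarith
    have hden : 0 < Δ * ((M : ℝ) - p) := mul_pos hΔ0 (by linarith)
    have hcontact : ∀ j, ∑ i, ‖dotProduct (e (Fin.castLE (by omega : p + 1 ≤ M + 1) i)) (a j)‖ ^ 2 =
        contactRatio (U z) (H j) p := fun j => by
      rw [he.contactRatio_eq (by omega) (hX p hp), hstar]
    have hcard := hc p hp.le _ (IsAdaptedFrame.mem_framedPoints hcone he (by omega : p + 1 ≤ M + 1))
    simp only [hcontact] at hcard
    have h1 := prod_rpow_le_mul_sum (hΦ0 p hp) (θ := 1 / (Δ * (M - p))) (by positivity) hK1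
      (Finset.univ.filter fun j => contactRatio (U z) (H j) p < c p)
      (by rwa [mul_one_div, div_le_one hden]) (fun j hj => by
        have hj' : c p ≤ contactRatio (U z) (H j) p := by simpa using hj
        have hL1 : 1 ≤ Real.log (δ / contactRatio (U z) (H j) p) := hΛ1.trans (hL p hp j)
        refine le_trans ?_ (hcK p hp)
        refine div_le_div₀ (by linarith) (hφB (p + 1) hp j) (hc0 p) ?_
        nlinarith [hc0 p, one_le_pow₀ hL1 (n := 2)])
      (by
        rw [Fintype.card_fin, mul_one_div, le_div_iff₀ hden, one_mul]
        have hp0 : (0 : ℝ) ≤ p := Nat.cast_nonneg p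
        nlinarith)
    rw [Fintype.card_fin] at h1
    rw [inv_mul_le_iff₀ hKpos]
    refine h1.trans (mul_le_mul_of_nonneg_right ?_ (Finset.sum_nonneg fun j _ => hΦ0 p hp j))
    refine Real.rpow_le_rpow_of_exponent_le hK1 (mul_le_mul_of_nonneg_left ?_ hq0.le)
    exact one_div_le_one_div_of_le hΔ0 (by nlinarith)
  have hbase : extNorm (wedgeSeq (U z) 1) ^ (2 * ((q : ℝ) / Δ - M - 1)) =
      (extNorm (wedgeSeq (U z) 1) ^ 2) ^ ((q : ℝ) / Δ - M - 1) := by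
    rw [Real.rpow_mul (extNorm_nonneg _)]
    norm_num
  have hg : ∀ j, extNorm (interiorProduct (wedgeSeq (U z) 1) (H j)) ^ 2 =
      extNorm (wedgeSeq (U z) 1) ^ 2 * contactRatio (U z) (H j) 0 := fun j => by
    rw [contactRatio]
    exact (mul_div_cancel₀ _ (pow_pos (extNorm_pos (hX' 0 (by omega))) 2).ne').symm
  simp only [hbase, hg]
  rw [hC, mul_assoc (2 / Δ), mul_assoc (2 / Δ)]
  refine mul_le_mul_of_nonneg_left ?_ (by positivity)
  rw [mul_assoc]
  refine (mul_le_mul_of_nonneg_left hmean (inv_pos.2 hKpos).le).trans ?_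
  rw [Finset.mul_sum]
  refine Finset.sum_le_sum fun p hp => ?_
  rw [mul_left_comm]
  exact mul_le_mul_of_nonneg_left (hps p (Finset.mem_range.1 hp)) (curvature_nonneg _ _)
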